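/- Let $M$ be a smooth ($C^\infty$, Hausdorff, second countable, boundaryless) manifold of dimension $q\ge 1$ with a continuous Riemannian metric, whose norms are used on tangent spaces. Let $\mathcal V$ be a smooth vector field on $M$ with evolution operators $\{\phi^t\}_{t\in\mathbb R}$, i.e. a group of $C^1$ diffeomorphisms of $M$ with $\phi^{0}=\mathrm{id}$ and $\phi^{s+t}=\phi^s\phi^t$ such that $t\mapsto\phi^t(m)$ is an integral curve of $\mathcal V$ for every $m\in M$. Let $N\ge q$, let $A$ be a real symmetric positive definite $N\times N$ matrix with smallest eigenvalue $\sigma_{\min}$, and let $C\in\mathbb R^N$. Let $C^1(M,\mathbb R)$ denote the set of $C^1$ functions $\omega:M\to\mathbb R$ with $\sup_M|\omega|<\infty$ and $\sup_M\|D\omega\|<\infty$, with the metric $\sup_M|\omega-\omega'|+\sup_M\|D\omega-D\omega'\|$. For $\omega\in C^1(M,\mathbb R)$ consider the linear reservoir system $\dot x(t)=-Ax(t)+C\,\omega(\phi^t(m))$ and put $$f_\omega(m)=\int_0^\infty e^{-A\tau}C\,\omega(\phi^{-\tau}(m))\,d\tau .$$ Assume that there are $c\in(0,1)$ and $K>0$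 with $$\|T_m\phi^{-t}\|\le K e^{c\sigma_{\min}t}\qquad\text{for all } m\in M,\ t\ge 0,$$ that $\mathcal V$ has finitely many fixed points (zeros), and that at each fixed point $m$ the Jacobian $J_m:T_mM\to T_mM$ of $\mathcal V$ has $q$ distinct complex eigenvalues $\lambda_1,\dots,\lambda_q$ for which the vectors $(A+\lambda_j\mathbb I)^{-1}C$, $j=1,\dots,q$, are linearly independent in $\mathbb C^N$. Then, for every $\omega\in C^1(M,\mathbb R)$, $f_\omega$ is a generalised synchronisation (GS) of the reservoir system: $\|f_\omega(\phi^t(m))-x(t)\|\to0$ as $t\to\infty$ for every $m\in M$ and every solution $x:\mathbb R\to\mathbb R^N$, whatever $x(0)\in\mathbb R^N$. Moreover, for generic $\omega$ the GS $f_\omega$ is an embedding on the fixed points: the set of those $\omega\in C^1(M,\mathbb R)$ for which $f_\omega$ is differentiable with injective derivative at every fixed point of $\mathcal V$, and injective on the set of fixed points, is open and dense in $C^1(M,\mathbb R)$. -/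

import Mathlib

open Set Filter Topology MeasureTheory Manifold
open scoped ContDiff Bundle

noncomputable section

/-! ### The space `C¹(M, ℝ)` with the `C¹` metric -/

/-- `C¹` observation functions `obs : M → ℝ` on a `q`-dimensional manifold whose tangent spaces carry
norms (a Riemannian metric), with `sup |obs| < ∞` and `sup ‖D obs‖ < ∞`. -/
structure ObsC1 (q : ℕ) (M : Type*) [TopologicalSpace M]
    [ChartedSpace (EuclideanSpace ℝ (Fin q)) M] [IsManifold (𝓡 q) ∞ M]
    [Bundle.RiemannianBundle (fun m : M => TangentSpace (𝓡 q) m)] where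
  toFun : M → ℝ
  contMDiff : ContMDiff (𝓡 q) 𝓘(ℝ, ℝ) 1 toFun
  bounded : BddAbove (range fun m => |toFun m|)
  deriv_bounded : BddAbove (range fun m => ‖mvfderiv (𝓡 q) toFun m‖)

namespace ObsC1

variable {q : ℕ} {M : Type*} [TopologicalSpace M]
  [ChartedSpace (EuclideanSpace ℝ (Fin q)) M] [IsManifold (𝓡 q) ∞ M]
  [Bundle.RiemannianBundle (fun m : M => TangentSpace (𝓡 q) m)]

instance : CoeFun (ObsC1 q M) (fun _ => M → ℝ) := ⟨toFun⟩

theorem bddAbove_sub (a b : ObsC1 q M) : BddAbove (range fun m => |a m - b m|) := by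
  obtain ⟨x, hx⟩ := a.bounded
  obtain ⟨y, hy⟩ := b.bounded
  refine ⟨x + y, ?_⟩
  rintro _ ⟨m, rfl⟩
  exact (abs_sub _ _).trans (add_le_add (hx ⟨m, rfl⟩) (hy ⟨m, rfl⟩))

theorem bddAbove_deriv_sub (a b : ObsC1 q M) :
    BddAbove (range fun m => ‖mvfderiv (𝓡 q) a m - mvfderiv (𝓡 q) b m‖) := by
  obtain ⟨x, hx⟩ := a.deriv_bounded
  obtain ⟨y, hy⟩ := b.deriv_bounded
  refine ⟨x + y, ?_⟩
  rintro _ ⟨m, rfl⟩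
  exact (norm_sub_le (mvfderiv (𝓡 q) a m) (mvfderiv (𝓡 q) b m)).trans
    (add_le_add (hx (mem_range_self m)) (hy (mem_range_self m)))

/-- The `C¹` distance `sup |a - b| + sup ‖Da - Db‖`. -/
instance : MetricSpace (ObsC1 q M) where
  dist a b := (⨆ m, |a m - b m|) + ⨆ m, ‖mvfderiv (𝓡 q) a m - mvfderiv (𝓡 q) b m‖
  dist_self a := by
    have h (m : M) : ‖mvfderiv (𝓡 q) a m - mvfderiv (𝓡 q) a m‖ = 0 := by
      rw [sub_self]
      exact ContinuousLinearMap.opNorm_zero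
    simp only [h]
    simp
  dist_comm a b := by simp only [abs_sub_comm (a _), norm_sub_rev (mvfderiv (𝓡 q) a _)]
  dist_triangle a b c := by
    have h1 : (⨆ m, |a m - c m|) ≤ (⨆ m, |a m - b m|) + ⨆ m, |b m - c m| := by
      refine Real.iSup_le (fun m => ?_)
        (add_nonneg (Real.iSup_nonneg fun _ => abs_nonneg _)
          (Real.iSup_nonneg fun _ => abs_nonneg _))
      exact (abs_sub_le _ (b m) _).trans
        (add_le_add (le_ciSup (bddAbove_sub a b) m) (le_ciSup (bddAbove_sub b c) m))
    have h2 : (⨆ m, ‖mvfderiv (𝓡 q) a m - mvfderiv (𝓡 q) c m‖) ≤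
        (⨆ m, ‖mvfderiv (𝓡 q) a m - mvfderiv (𝓡 q) b m‖) +
          ⨆ m, ‖mvfderiv (𝓡 q) b m - mvfderiv (𝓡 q) c m‖ := by
      refine Real.iSup_le (fun m => ?_)
        (add_nonneg (Real.iSup_nonneg fun _ => ContinuousLinearMap.opNorm_nonneg _)
          (Real.iSup_nonneg fun _ => ContinuousLinearMap.opNorm_nonneg _))
      exact (norm_sub_le_norm_sub_add_norm_sub _ (mvfderiv (𝓡 q) b m) _).trans
        (add_le_add (le_ciSup (bddAbove_deriv_sub a b) m) (le_ciSup (bddAbove_deriv_sub b c) m))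
    linarith
  eq_of_dist_eq_zero {a b} h := by
    have h0 : (⨆ m, |a m - b m|) ≤ 0 := by
      have : 0 ≤ ⨆ m, ‖mvfderiv (𝓡 q) a m - mvfderiv (𝓡 q) b m‖ :=
        Real.iSup_nonneg fun _ => ContinuousLinearMap.opNorm_nonneg _
      change (_ : ℝ) + _ = 0 at h
      linarith
    have hab : a.toFun = b.toFun := by
      funext m
      have := (le_ciSup (bddAbove_sub a b) m).trans h0
      exact sub_eq_zero.1 (abs_eq_zero.1 (le_antisymm this (abs_nonneg _)))
    cases a; cases b; cases hab; rfl

end ObsC1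

/-! ### The source system -/

/-- `φ` is the group of evolution operators of the vector field `v`: a one-parameter group of `C¹`
diffeomorphisms of `M` (the inverse of `φ t` is `φ (-t)`) whose orbits are integral curves. -/
structure IsEvolution {q : ℕ} {M : Type*} [TopologicalSpace M]
    [ChartedSpace (EuclideanSpace ℝ (Fin q)) M] [IsManifold (𝓡 q) ∞ M]
    (v : (m : M) → TangentSpace (𝓡 q) m) (φ : ℝ → M → M) : Prop where
  zero : ∀ m, φ 0 m = m
  add : ∀ s t m, φ (s + t) m = φ s (φ t m)
  contMDiff : ∀ t, ContMDiff (𝓡 q) (𝓡 q) 1 (φ t)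
  integralCurve : ∀ m, IsMIntegralCurve (I := 𝓡 q) (fun t => φ t m) v

/-- The Jacobian at `m` of the vector field `v`: the derivative at `m` of the representative of `v`
in the preferred chart at `m`, by which Mathlib identifies `T_m M` with `ℝ^q`. At a zero of `v` it is
the intrinsic linearisation `T_m M → T_m M`. -/
def jacobian {q : ℕ} {M : Type*} [TopologicalSpace M]
    [ChartedSpace (EuclideanSpace ℝ (Fin q)) M] [IsManifold (𝓡 q) ∞ M]
    (v : (m : M) → TangentSpace (𝓡 q) m) (m : M) :
    EuclideanSpace ℝ (Fin q) →L[ℝ] EuclideanSpace ℝ (Fin q) :=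
  mvfderiv (𝓡 q)
    (fun x => (trivializationAt (EuclideanSpace ℝ (Fin q)) (TangentSpace (𝓡 q) (M := M)) m
      (Bundle.TotalSpace.mk' (EuclideanSpace ℝ (Fin q)) x (v x))).2) m

/-! ### Reservoir systems and generalised synchronisations

Only the topology and the linear structure of the reservoir space `ℝ^N` are used. -/

/-- `x` solves `x'(t) = F (x t) (obs (φ^t m))` on `ℝ`. -/
def IsReservoirSolution {M : Type*} {N : ℕ} (F : (Fin N → ℝ) → ℝ → (Fin N → ℝ))
    (φ : ℝ → M → M) (obs : M → ℝ) (m : M) (x : ℝ → Fin N → ℝ) : Prop :=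
  ∀ t, HasDerivAt x (F (x t) (obs (φ t m))) t

/-- `f` is a `V`-generalised synchronisation: for all `r ∈ V` and `m`, the reservoir solution `x`
starting at `r` satisfies `‖f (φ^t m) - x t‖ → 0`. -/
def IsGeneralisedSync {M : Type*} {N : ℕ} (F : (Fin N → ℝ) → ℝ → (Fin N → ℝ))
    (φ : ℝ → M → M) (obs : M → ℝ) (V : Set (Fin N → ℝ)) (f : M → Fin N → ℝ) : Prop :=
  ∀ r ∈ V, ∀ m, ∀ x, IsReservoirSolution F φ obs m x → x 0 = r →
    Tendsto (fun t => ‖f (φ t m) - x t‖) atTop (𝓝 0)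

/-- The linear reservoir map `F(x, z) = -A x + C z`. -/
def linearReservoir {N : ℕ} (A : Matrix (Fin N) (Fin N) ℝ) (C : Fin N → ℝ)
    (x : Fin N → ℝ) (z : ℝ) : Fin N → ℝ :=
  -(A.mulVec x) + z • C

/-- The generalised synchronisation of the linear reservoir system,
`f(m) = ∫_0^∞ e^{-Aτ} C obs(φ^{-τ} m) dτ`. -/
def linearGS {M : Type*} {N : ℕ} (A : Matrix (Fin N) (Fin N) ℝ) (C : Fin N → ℝ)
    (φ : ℝ → M → M) (obs : M → ℝ) (m : M) : Fin N → ℝ :=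
  ∫ τ in Ioi (0 : ℝ), obs (φ (-τ) m) • (NormedSpace.exp (-τ • A)).mulVec C

/-- The smallest eigenvalue of a real symmetric matrix (its spectrum is finite, and nonempty as soon
as `0 < N`). -/
def minEigenvalue {N : ℕ} (A : Matrix (Fin N) (Fin N) ℝ) : ℝ := sInf (spectrum ℝ A)

/-- `f` is an embedding on `X`: it is an immersion at each point of `X` and injective on `X`. -/
def IsEmbeddingOn {q N : ℕ} {M : Type*} [TopologicalSpace M]
    [ChartedSpace (EuclideanSpace ℝ (Fin q)) M] (f : M → Fin N → ℝ) (X : Set M) : Prop :=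
  (∀ m ∈ X, MDifferentiableAt (𝓡 q) 𝓘(ℝ, Fin N → ℝ) f m ∧
    Function.Injective (mvfderiv (𝓡 q) f m)) ∧ InjOn f X

end

/-!
The proof rests on one identity. Along every orbit, `t ↦ f(φ^t m)` is
`e^{-At} ∫_{-∞}^t obs(φ^s m) e^{As} C ds`, hence it is itself a solution of the reservoir equation
(`isReservoirSolution_linearGS`). Two solutions with the same input differ by a solution of
`z' = -A z`, which decays to zero since `A` is positive definite; this is generalised
synchronisation.

Since `Tφ^{-τ}` grows more slowly than `e^{-Aτ}` decays, the integral defining `f` can be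
differentiated under the integral sign, and `f` is `C¹`
(`exists_hasFDerivAt_linearGS_comp_extChartAt_symm`). The reservoir equation at `t = 0` then reads
`Df(y) v(y) = -A f(y) + obs(y) C`. Linearising it at a zero `m` of `v`, where `Df` need only be
continuous because `v` vanishes, yields a Sylvester equation for `L = Df(m)`, with `J` the Jacobian
of `v` (`linearGS_sylvester`): `L J = -A L + C ⊗ D obs(m)`. No information on the derivative of the
flow with respect to the initial point is needed beyond the growth bound.

Applied to a complex eigenvector `w_j` of `J`, the Sylvester equation gives
`L w_j = D obs(m)(w_j) (A + λ_j)⁻¹ C`. As the `w_j` form a basis and the vectors `(A + λ_j)⁻¹ C` are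
linearly independent, `L` is injective if and only if every `D obs(m)(w_j)` is nonzero
(`exists_eigenvectors_injective_iff`). At fixed points the reservoir equation reads
`A f(m) = obs(m) C`, so `f` separates them if and only if `obs` does (`linearGS_injOn_iff`).

The observation functions in question are therefore those on which finitely many continuous linear
functionals, `obs ↦ D obs(m)(w_j)` and `obs ↦ obs(m) - obs(m')`, do not vanish. Bump functions
in charts show that none of these functionals is identically zero, and the complement of finitely
many proper closed subspaces is open and dense (`ObsC1.isOpen_and_dense_forall_ne_zero`).
-/

/-! ### The linear reservoir system -/

section LinearReservoir

variable {N : ℕ}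

theorem minEigenvalue_pos (hN : 0 < N) {A : Matrix (Fin N) (Fin N) ℝ} (hA : A.PosDef) :
    0 < minEigenvalue A := by
  have : Nonempty (Fin N) := ⟨⟨0, hN⟩⟩
  rw [minEigenvalue, hA.isHermitian.spectrum_real_eq_range_eigenvalues]
  obtain ⟨i, hi⟩ := (range_nonempty hA.isHermitian.eigenvalues).csInf_mem (finite_range _)
  rw [← hi]
  exact hA.eigenvalues_pos i

theorem minEigenvalue_le_eigenvalues {A : Matrix (Fin N) (Fin N) ℝ} (hA : A.IsHermitian)
    (i : Fin N) : minEigenvalue A ≤ hA.eigenvalues i := by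
  rw [minEigenvalue, hA.spectrum_real_eq_range_eigenvalues]
  exact csInf_le (finite_range _).bddBelow (mem_range_self i)

/-- The exponential of a multiple of a symmetric matrix, diagonalised. -/
theorem exists_exp_smul_eq_conj_diagonal {A : Matrix (Fin N) (Fin N) ℝ} (hA : A.IsHermitian) :
    ∃ P Q : Matrix (Fin N) (Fin N) ℝ, ∀ t : ℝ, NormedSpace.exp (t • A) =
      P * Matrix.diagonal (fun k => Real.exp (t * hA.eigenvalues k)) * Q := by
  set U : Matrix (Fin N) (Fin N) ℝ := (hA.eigenvectorUnitary : Matrix (Fin N) (Fin N) ℝ)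
  have h1 : U * star U = 1 := Unitary.coe_mul_star_self _
  have hunit : IsUnit U := IsUnit.of_mul_eq_one _ h1
  have hinv : U⁻¹ = star U := Matrix.inv_eq_right_inv h1
  refine ⟨U, star U, fun t => ?_⟩
  have h2 : t • A = U * Matrix.diagonal (fun k => t * hA.eigenvalues k) * U⁻¹ := by
    conv_lhs => rw [hA.spectral_theorem, Unitary.conjStarAlgAut_apply]
    rw [hinv, ← Matrix.smul_mul, ← Matrix.mul_smul, ← Matrix.diagonal_smul]
    rfl
  rw [h2, Matrix.exp_conj _ _ hunit, Matrix.exp_diagonal, hinv]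
  congr 3
  funext k
  rw [Real.exp_eq_exp_ℝ, Pi.coe_exp]

theorem exists_norm_exp_neg_smul_mulVec_le {A : Matrix (Fin N) (Fin N) ℝ} (hA : A.IsHermitian)
    (x : Fin N → ℝ) : ∃ B : ℝ, 0 ≤ B ∧ ∀ t, 0 ≤ t →
      ‖(NormedSpace.exp (-t • A)).mulVec x‖ ≤ B * Real.exp (-(minEigenvalue A * t)) := by
  obtain ⟨P, Q, h⟩ := exists_exp_smul_eq_conj_diagonal hA
  have hB (i : Fin N) : 0 ≤ ∑ k, |P i k| * |Q.mulVec x k| := by positivity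
  refine ⟨∑ i, ∑ k, |P i k| * |Q.mulVec x k|, Finset.sum_nonneg fun i _ => hB i, fun t ht => ?_⟩
  refine (pi_norm_le_iff_of_nonneg (mul_nonneg (Finset.sum_nonneg fun i _ => hB i)
    (Real.exp_nonneg _))).2 fun i => ?_
  rw [h, ← Matrix.mulVec_mulVec, ← Matrix.mulVec_mulVec]
  calc ‖P.mulVec ((Matrix.diagonal fun k => Real.exp (-t * hA.eigenvalues k)).mulVec
          (Q.mulVec x)) i‖
      ≤ ∑ k, |P i k| * |Q.mulVec x k| * Real.exp (-(minEigenvalue A * t)) := by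
        change |∑ k, P i k * (Matrix.diagonal _).mulVec (Q.mulVec x) k| ≤ _
        refine (Finset.abs_sum_le_sum_abs _ _).trans (Finset.sum_le_sum fun k _ => ?_)
        rw [Matrix.mulVec_diagonal, abs_mul, abs_mul, Real.abs_exp, mul_assoc]
        refine mul_le_mul_of_nonneg_left ?_ (abs_nonneg _)
        rw [mul_comm]
        refine mul_le_mul_of_nonneg_left (Real.exp_le_exp.2 ?_) (abs_nonneg _)
        have := mul_le_mul_of_nonneg_left (minEigenvalue_le_eigenvalues hA k) ht
        linarith
    _ = (∑ k, |P i k| * |Q.mulVec x k|) * Real.exp (-(minEigenvalue A * t)) :=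
        (Finset.sum_mul ..).symm
    _ ≤ _ := mul_le_mul_of_nonneg_right
        (Finset.single_le_sum (f := fun i => ∑ k, |P i k| * |Q.mulVec x k|)
          (fun i _ => hB i) (Finset.mem_univ i)) (Real.exp_nonneg _)

open scoped Matrix.Norms.Operator in
theorem hasDerivAt_exp_smul_mulVec (A : Matrix (Fin N) (Fin N) ℝ) {x : ℝ → Fin N → ℝ}
    {x' : Fin N → ℝ} {t : ℝ} (hx : HasDerivAt x x' t) :
    HasDerivAt (fun s => (NormedSpace.exp (s • A)).mulVec (x s))
      ((NormedSpace.exp (t • A)).mulVec (A.mulVec (x t) + x')) t := by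
  have h := hasDerivAt_exp_smul_const (𝕂 := ℝ) A t
  have hA (i k : Fin N) : HasDerivAt (fun s => NormedSpace.exp (s • A) i k)
      ((NormedSpace.exp (t • A) * A) i k) t :=
    (Matrix.entryLinearMap ℝ ℝ i k).toContinuousLinearMap.hasFDerivAt.comp_hasDerivAt t h
  rw [hasDerivAt_pi]
  intro i
  have := HasDerivAt.fun_sum (u := Finset.univ) fun k _ => (hA i k).mul ((hasDerivAt_pi.1 hx) k)
  refine this.congr_deriv ?_
  rw [Matrix.mulVec_add, Matrix.mulVec_mulVec]
  simp [Matrix.mulVec, dotProduct, Finset.sum_add_distrib]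

theorem exp_neg_smul_mul_exp_smul (A : Matrix (Fin N) (Fin N) ℝ) (t : ℝ) :
    NormedSpace.exp (-t • A) * NormedSpace.exp (t • A) = 1 := by
  rw [← Matrix.exp_add_of_commute, neg_smul, neg_add_cancel, NormedSpace.exp_zero]
  exact ((Commute.refl A).smul_left _).smul_right _

theorem exp_smul_mul_exp_neg_smul (A : Matrix (Fin N) (Fin N) ℝ) (t : ℝ) :
    NormedSpace.exp (t • A) * NormedSpace.exp (-t • A) = 1 := by
  simpa using exp_neg_smul_mul_exp_smul A (-t)

theorem hasDerivAt_exp_neg_smul_mulVec (A : Matrix (Fin N) (Fin N) ℝ) {x : ℝ → Fin N → ℝ}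
    {x' : Fin N → ℝ} {t : ℝ} (hx : HasDerivAt x x' t) :
    HasDerivAt (fun s => (NormedSpace.exp (-s • A)).mulVec (x s))
      (-(A.mulVec ((NormedSpace.exp (-t • A)).mulVec (x t))) +
        (NormedSpace.exp (-t • A)).mulVec x') t := by
  have h := hasDerivAt_exp_smul_mulVec (-A) hx
  simp only [smul_neg, ← neg_smul] at h
  refine h.congr_deriv ?_
  have hc : Commute (NormedSpace.exp (-t • A)) A :=
    (((Commute.refl A).smul_left (-t)).exp_left)
  rw [Matrix.mulVec_add, Matrix.neg_mulVec, Matrix.mulVec_neg, Matrix.mulVec_mulVec,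
    Matrix.mulVec_mulVec, hc.eq]

theorem continuous_exp_smul_mulVec (A : Matrix (Fin N) (Fin N) ℝ) (x : Fin N → ℝ) :
    Continuous fun s : ℝ => (NormedSpace.exp (s • A)).mulVec x :=
  continuous_iff_continuousAt.2 fun s =>
    (hasDerivAt_exp_smul_mulVec A (hasDerivAt_const s x)).continuousAt

/-- Solutions of the homogeneous system `z' = -A z` decay to zero. -/
theorem tendsto_norm_of_hasDerivAt_neg_mulVec (hN : 0 < N) {A : Matrix (Fin N) (Fin N) ℝ}
    (hA : A.PosDef) {z : ℝ → Fin N → ℝ} (hz : ∀ t, HasDerivAt z (-(A.mulVec (z t))) t) :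
    Tendsto (fun t => ‖z t‖) atTop (𝓝 0) := by
  have hconst (t : ℝ) : (NormedSpace.exp (t • A)).mulVec (z t) = z 0 := by
    have h (s : ℝ) : HasDerivAt (fun s => (NormedSpace.exp (s • A)).mulVec (z s)) 0 s := by
      simpa using hasDerivAt_exp_smul_mulVec A (hz s)
    have := is_const_of_deriv_eq_zero (fun s => (h s).differentiableAt) (fun s => (h s).deriv) t 0
    simpa using this
  have hz' (t : ℝ) : z t = (NormedSpace.exp (-t • A)).mulVec (z 0) := by
    rw [← hconst t, Matrix.mulVec_mulVec, exp_neg_smul_mul_exp_smul, Matrix.one_mulVec]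
  obtain ⟨B, -, hB⟩ := exists_norm_exp_neg_smul_mulVec_le hA.isHermitian (z 0)
  have hlim : Tendsto (fun t : ℝ => B * Real.exp (-(minEigenvalue A * t))) atTop (𝓝 0) := by
    have := Real.tendsto_exp_neg_atTop_nhds_zero.comp
      (tendsto_id.const_mul_atTop (minEigenvalue_pos hN hA))
    simpa using this.const_mul B
  refine squeeze_zero' (Eventually.of_forall fun t => norm_nonneg _) ?_ hlim
  filter_upwards [eventually_ge_atTop 0] with t ht
  rw [hz' t]
  exact hB t ht

theorem integrableOn_exp_neg_mul {a : ℝ} (ha : 0 < a) (B : ℝ) :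
    IntegrableOn (fun t : ℝ => B * Real.exp (-(a * t))) (Ioi 0) := by
  simpa only [neg_mul, IntegrableOn] using (exp_neg_integrableOn_Ioi 0 ha).const_mul B

/-- The memory integral of a bounded continuous input is absolutely convergent. -/
theorem integrableOn_smul_exp_neg_smul_mulVec (hN : 0 < N) {A : Matrix (Fin N) (Fin N) ℝ}
    (hA : A.PosDef) (C : Fin N → ℝ) {u : ℝ → ℝ} (hu : Continuous u) {D : ℝ}
    (hD : ∀ s, |u s| ≤ D) :
    IntegrableOn (fun τ : ℝ => u τ • (NormedSpace.exp (-τ • A)).mulVec C) (Ioi 0) := by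
  obtain ⟨B, hB0, hB⟩ := exists_norm_exp_neg_smul_mulVec_le hA.isHermitian C
  refine Integrable.mono' (integrableOn_exp_neg_mul (minEigenvalue_pos hN hA) (D * B))
    (hu.smul ((continuous_exp_smul_mulVec A C).comp continuous_neg)).aestronglyMeasurable ?_
  refine (ae_restrict_iff' measurableSet_Ioi).2 (ae_of_all _ fun τ hτ => ?_)
  rw [norm_smul, mul_assoc]
  exact mul_le_mul (hD τ) (hB τ (le_of_lt hτ)) (norm_nonneg _) ((abs_nonneg _).trans (hD τ))

/-- The memory integral `t ↦ ∫_0^∞ u(t - τ) e^{-Aτ} C dτ` solves the reservoir equation driven by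
the input `u`. It is `e^{-At} ∫_{-∞}^t u(s) e^{As} C ds`, which is differentiated by the product
rule. -/
theorem hasDerivAt_memoryIntegral (hN : 0 < N) {A : Matrix (Fin N) (Fin N) ℝ}
    (hA : A.PosDef) (C : Fin N → ℝ) {u : ℝ → ℝ} (hu : Continuous u) {D : ℝ}
    (hD : ∀ s, |u s| ≤ D) (t : ℝ) :
    HasDerivAt (fun t => ∫ τ in Ioi (0 : ℝ), u (-τ + t) • (NormedSpace.exp (-τ • A)).mulVec C)
      (linearReservoir A C
        (∫ τ in Ioi (0 : ℝ), u (-τ + t) • (NormedSpace.exp (-τ • A)).mulVec C) (u t)) t := by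
  set g : ℝ → Fin N → ℝ := fun s => u s • (NormedSpace.exp (s • A)).mulVec C with hg
  have hgc : Continuous g := hu.smul (continuous_exp_smul_mulVec A C)
  have hint0 : IntegrableOn g (Iic 0) := by
    have := integrableOn_smul_exp_neg_smul_mulVec hN hA C (hu.comp continuous_neg) fun s => hD (-s)
    rw [← integrableOn_Ici_iff_integrableOn_Ioi] at this
    have := this.comp_neg
    simpa [hg, Function.comp_def] using this
  have hint (t : ℝ) : IntegrableOn g (Iic t) := by
    refine (hint0.union (hgc.integrableOn_Icc (a := 0) (b := t))).mono_set fun s hs => ?_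
    rcases le_total s 0 with h | h
    · exact Or.inl h
    · exact Or.inr ⟨h, hs⟩
  -- substitute `s = t - τ` and split the exponential
  have hrepr (t : ℝ) : (∫ τ in Ioi (0 : ℝ), u (-τ + t) • (NormedSpace.exp (-τ • A)).mulVec C) =
      (NormedSpace.exp (-t • A)).mulVec (∫ s in Iic t, g s) := by
    have h1 (τ : ℝ) : u (-τ + t) • (NormedSpace.exp (-τ • A)).mulVec C =
        (NormedSpace.exp (-t • A)).mulVec (g (-τ + t)) := by
      have : -τ • A = -t • A + (-τ + t) • A := by rw [← add_smul]; congr 1; ring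
      rw [this, Matrix.exp_add_of_commute _ _ (((Commute.refl A).smul_left _).smul_right _),
        ← Matrix.mulVec_mulVec, hg, Matrix.mulVec_smul]
    simp_rw [h1]
    have h2 : (∫ s in Iic t, g s) = ∫ τ in Ioi (0 : ℝ), g (-τ + t) := by
      rw [integral_comp_neg_Ioi 0 (fun s => g (s + t)), neg_zero,
        ← integral_indicator measurableSet_Iic, ← integral_indicator measurableSet_Iic,
        ← integral_add_right_eq_self _ t]
      congr 1
      funext s
      by_cases hs : s ≤ 0 <;> simp [indicator, hs]
    have h3 : IntegrableOn (fun τ : ℝ => g (-τ + t)) (Ioi 0) := by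
      have := (Matrix.mulVecLin (NormedSpace.exp (t • A))).toContinuousLinearMap.integrable_comp
        (integrableOn_smul_exp_neg_smul_mulVec hN hA C
          (hu.comp (continuous_neg.add_const t)) fun s => hD (-s + t))
      refine this.congr (ae_of_all _ fun τ => ?_)
      change (NormedSpace.exp (t • A)).mulVec
        (u (-τ + t) • (NormedSpace.exp (-τ • A)).mulVec C) = g (-τ + t)
      rw [h1, Matrix.mulVec_mulVec, exp_smul_mul_exp_neg_smul, Matrix.one_mulVec]
    rw [h2]
    exact (Matrix.mulVecLin (NormedSpace.exp (-t • A))).toContinuousLinearMap.integral_comp_comm h3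
  have hderiv : HasDerivAt (fun t => ∫ s in Iic t, g s) (g t) t := by
    have h1 : (fun t => ∫ s in Iic t, g s) =
        fun t => (∫ s in Iic (0 : ℝ), g s) + ∫ s in (0 : ℝ)..t, g s := by
      funext t
      rw [← intervalIntegral.integral_Iic_sub_Iic (hint 0) (hint t)]
      abel
    rw [h1]
    exact (intervalIntegral.integral_hasDerivAt_right (hgc.intervalIntegrable _ _)
      (hgc.stronglyMeasurableAtFilter _ _) hgc.continuousAt).const_add _
  simp_rw [hrepr]
  refine (hasDerivAt_exp_neg_smul_mulVec A hderiv).congr_deriv ?_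
  rw [linearReservoir, hg, Matrix.mulVec_smul, Matrix.mulVec_mulVec C, exp_neg_smul_mul_exp_smul,
    Matrix.one_mulVec]

variable {q : ℕ} {M : Type*} [TopologicalSpace M]
  [ChartedSpace (EuclideanSpace ℝ (Fin q)) M] [IsManifold (𝓡 q) ∞ M]
  [Bundle.RiemannianBundle (fun m : M => TangentSpace (𝓡 q) m)]
  {v : (m : M) → TangentSpace (𝓡 q) m} {φ : ℝ → M → M}

theorem ObsC1.exists_abs_le (obs : ObsC1 q M) : ∃ D, ∀ m, |obs m| ≤ D :=
  obs.bounded.imp fun _ h m => h (mem_range_self m)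

omit [Bundle.RiemannianBundle (fun m : M => TangentSpace (𝓡 q) m)] in
theorem IsEvolution.continuous_orbit (hφ : IsEvolution v φ) (m : M) :
    Continuous fun t => φ t m :=
  (hφ.integralCurve m).continuous

/-- The transform `f` evaluated along the orbit of any `m` is itself a reservoir solution. -/
theorem isReservoirSolution_linearGS (hN : 0 < N) {A : Matrix (Fin N) (Fin N) ℝ}
    (hA : A.PosDef) (C : Fin N → ℝ) (hφ : IsEvolution v φ) (obs : ObsC1 q M) (m : M) :
    IsReservoirSolution (linearReservoir A C) φ obs m
      (fun t => linearGS A C φ obs (φ t m)) := by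
  intro t
  obtain ⟨D, hD⟩ := obs.exists_abs_le
  have := hasDerivAt_memoryIntegral hN hA C
    (obs.contMDiff.continuous.comp (hφ.continuous_orbit m)) (fun s => hD (φ s m)) t
  simpa only [linearGS, ← hφ.add, Function.comp_apply] using this

theorem isGeneralisedSync_linearGS (hN : 0 < N) {A : Matrix (Fin N) (Fin N) ℝ}
    (hA : A.PosDef) (C : Fin N → ℝ) (hφ : IsEvolution v φ) (obs : ObsC1 q M) :
    IsGeneralisedSync (linearReservoir A C) φ obs univ (linearGS A C φ obs) := by
  intro r _ m x hx _
  refine tendsto_norm_of_hasDerivAt_neg_mulVec hN hA fun t =>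
    ((isReservoirSolution_linearGS hN hA C hφ obs m t).sub (hx t)).congr_deriv ?_
  rw [linearReservoir, linearReservoir, Matrix.mulVec_sub]
  abel

/-- At a point fixed by the flow, `f` solves the stationary equation `A f = obs • C`. -/
theorem mulVec_linearGS_of_fixed (hN : 0 < N) {A : Matrix (Fin N) (Fin N) ℝ}
    (hA : A.PosDef) (C : Fin N → ℝ) (hφ : IsEvolution v φ) (obs : ObsC1 q M) {m : M}
    (hm : ∀ t, φ t m = m) : A.mulVec (linearGS A C φ obs m) = obs m • C := by
  have h := isReservoirSolution_linearGS hN hA C hφ obs m 0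
  simp only [hm] at h
  have := h.unique (hasDerivAt_const _ _)
  rw [linearReservoir, neg_add_eq_zero] at this
  exact this

end LinearReservoir

/-! ### Differential calculus in normed spaces -/

section Calculus

variable {E F : Type*} [NormedAddCommGroup E] [NormedSpace ℝ E]
  [NormedAddCommGroup F] [NormedSpace ℝ F]

/-- Product rule for `y ↦ DG(y)(V y)` at a zero of `V`: since `V` vanishes there, continuity of `DG`
replaces its differentiability. -/
theorem hasFDerivAt_apply_of_eq_zero {G' : E → E →L[ℝ] F} {V : E → E} {V' : E →L[ℝ] E} {y₀ : E}
    (hG' : ContinuousAt G' y₀) (hV : HasFDerivAt V V' y₀) (hV0 : V y₀ = 0) :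
    HasFDerivAt (fun y => G' y (V y)) (G' y₀ ∘L V') y₀ := by
  have hO : V =O[𝓝 y₀] fun y => y - y₀ := by simpa [hV0] using hV.isBigO_sub
  have ho : (fun y => G' y - G' y₀) =o[𝓝 y₀] fun _ => (1 : ℝ) := by
    rw [Asymptotics.isLittleO_one_iff]
    simpa using hG'.sub_const (G' y₀)
  have h1 : (fun y => (G' y - G' y₀) (V y)) =o[𝓝 y₀] fun y => y - y₀ := by
    have hb : (fun y => (G' y - G' y₀) (V y)) =O[𝓝 y₀] fun y => ‖G' y - G' y₀‖ * ‖V y‖ :=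
      Asymptotics.IsBigO.of_bound 1 (Eventually.of_forall fun y => by
        simpa using (G' y - G' y₀).le_opNorm (V y))
    refine hb.trans_isLittleO ?_
    have := ho.norm_left.mul_isBigO hO.norm_left.norm_right
    simp only [one_mul] at this
    exact this.of_norm_right
  have h2 : (fun y => G' y₀ (V y) - G' y₀ (V' (y - y₀))) =o[𝓝 y₀] fun y => y - y₀ := by
    have := ((G' y₀).hasFDerivAt.comp y₀ hV).isLittleO
    simpa [hV0] using this
  refine .of_isLittleO ((h1.add h2).congr_left fun y => ?_)
  simp [hV0]

variable [FiniteDimensional ℝ E]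

/-- The derivative in `y` of a parametrised family of functions that is measurable in the parameter
is measurable in the parameter, being a limit of difference quotients. -/
theorem aestronglyMeasurable_of_hasFDerivAt {α : Type*} [MeasurableSpace α] {μ : Measure α}
    {g : α → E → ℝ} {g' : α → E →L[ℝ] ℝ} {y : E} {U : Set E} (hU : U ∈ 𝓝 y)
    (hmeas : ∀ z ∈ U, AEStronglyMeasurable (fun τ => g τ z) μ)
    (hg : ∀ τ, HasFDerivAt (g τ) (g' τ) y) : AEStronglyMeasurable g' μ := by
  have happly (e : E) : AEStronglyMeasurable (fun τ => g' τ e) μ := by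
    have hin : ∀ᶠ n : ℕ in atTop, y + (n : ℝ)⁻¹ • e ∈ U := by
      have : Tendsto (fun n : ℕ => y + (n : ℝ)⁻¹ • e) atTop (𝓝 (y + (0 : ℝ) • e)) :=
        tendsto_const_nhds.add (tendsto_inv_atTop_nhds_zero_nat.smul_const e)
      rw [zero_smul, add_zero] at this
      exact this hU
    obtain ⟨n₀, hn₀⟩ := eventually_atTop.1 hin
    refine aestronglyMeasurable_of_tendsto_ae (atTop : Filter ℕ)
      (f := fun n τ => ((n + n₀ : ℕ) : ℝ) • (g τ (y + ((n + n₀ : ℕ) : ℝ)⁻¹ • e) - g τ y))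
      (fun n => ((hmeas _ (hn₀ _ (Nat.le_add_left _ _))).sub
        (hmeas _ (mem_of_mem_nhds hU))).const_smul ((n + n₀ : ℕ) : ℝ)) (ae_of_all _ fun τ => ?_)
    exact ((hg τ).lim_real e).comp
      (tendsto_natCast_atTop_atTop.comp (tendsto_add_atTop_nat n₀))
  set b := Module.finBasis ℝ E
  have hsum : g' = fun τ => ∑ i, g' τ (b i) • LinearMap.toContinuousLinearMap (b.coord i) := by
    funext τ
    refine ContinuousLinearMap.ext fun e => ?_
    conv_lhs => rw [← b.sum_repr e, map_sum]
    simp [mul_comm]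
  rw [hsum]
  exact Finset.aestronglyMeasurable_fun_sum _ fun i _ => (happly (b i)).smul_const _

/-- Differentiation under the integral sign on `(0, ∞)` for integrands `g τ y • w τ`; continuity of
the derivative follows by dominated convergence. -/
theorem exists_hasFDerivAt_integral_smul {N : ℕ} {g : ℝ → E → ℝ} {g' : ℝ → E → E →L[ℝ] ℝ}
    {w : ℝ → Fin N → ℝ} {U : Set E} (hU : IsOpen U) (hw : Continuous w)
    (hcont : ∀ y ∈ U, Continuous fun τ => g τ y)
    (hg : ∀ τ, ∀ y ∈ U, HasFDerivAt (g τ) (g' τ y) y)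
    (hg'cont : ∀ τ, ContinuousOn (g' τ) U)
    (hint : ∀ y ∈ U, IntegrableOn (fun τ => g τ y • w τ) (Ioi 0))
    {bound : ℝ → ℝ} (hbound : IntegrableOn bound (Ioi 0))
    (hle : ∀ τ, 0 < τ → ∀ y ∈ U, ‖g' τ y‖ * ‖w τ‖ ≤ bound τ) :
    ∃ F' : E → E →L[ℝ] (Fin N → ℝ),
      (∀ y ∈ U, HasFDerivAt (fun y => ∫ τ in Ioi (0 : ℝ), g τ y • w τ) (F' y) y) ∧
      ContinuousOn F' U := by
  have hmeas (y : E) (hy : y ∈ U) : AEStronglyMeasurable (fun τ => (g' τ y).smulRight (w τ))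
      (volume.restrict (Ioi 0)) := by
    have h1 := aestronglyMeasurable_of_hasFDerivAt (μ := volume.restrict (Ioi (0 : ℝ)))
      (hU.mem_nhds hy) (fun z hz => (hcont z hz).aestronglyMeasurable) fun τ => hg τ y hy
    exact ((ContinuousLinearMap.smulRightL ℝ E (Fin N → ℝ)).continuous₂).comp_aestronglyMeasurable
      (h1.prodMk hw.aestronglyMeasurable)
  have hle' : ∀ᵐ τ ∂(volume.restrict (Ioi (0 : ℝ))), ∀ y ∈ U,
      ‖(g' τ y).smulRight (w τ)‖ ≤ bound τ :=
    (ae_restrict_iff' measurableSet_Ioi).2 (ae_of_all _ fun τ hτ y hy => by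
      rw [ContinuousLinearMap.norm_smulRight_apply]
      exact hle τ hτ y hy)
  refine ⟨fun y => ∫ τ in Ioi (0 : ℝ), (g' τ y).smulRight (w τ), fun y hy => ?_, fun y hy => ?_⟩
  · exact hasFDerivAt_integral_of_dominated_of_fderiv_le (hU.mem_nhds hy)
      (Filter.eventually_of_mem (hU.mem_nhds hy) fun z hz => (hint z hz).aestronglyMeasurable)
      (hint y hy) (hmeas y hy) hle' hbound
      (ae_of_all _ fun τ z hz => (hg τ z hz).smul_const (w τ))
  · refine ContinuousAt.continuousWithinAt ?_
    refine continuousAt_of_dominated (bound := bound)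
      (Filter.eventually_of_mem (hU.mem_nhds hy) hmeas)
      (Filter.eventually_of_mem (hU.mem_nhds hy) fun z hz => hle'.mono fun τ h => h z hz) hbound
      (ae_of_all _ fun τ => ?_)
    have := (hg'cont τ).continuousAt (hU.mem_nhds hy)
    exact ((ContinuousLinearMap.smulRightL ℝ E (Fin N → ℝ)).flip (w τ)).continuous.continuousAt.comp
      this

end Calculus

/-! ### Derivatives in charts and Riemannian norms -/

section Charts

variable {q : ℕ} {M : Type*} [TopologicalSpace M]
  [ChartedSpace (EuclideanSpace ℝ (Fin q)) M] [IsManifold (𝓡 q) ∞ M]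
  [Bundle.RiemannianBundle (fun m : M => TangentSpace (𝓡 q) m)]

omit [IsManifold (𝓡 q) ∞ M] [Bundle.RiemannianBundle (fun m : M => TangentSpace (𝓡 q) m)] in
theorem mvfderiv_eq_fderiv_comp_extChartAt_symm
    {F : Type*} [NormedAddCommGroup F] [NormedSpace ℝ F] {g : M → F} {m : M}
    (hg : MDifferentiableAt (𝓡 q) 𝓘(ℝ, F) g m) :
    mvfderiv (𝓡 q) g m = fderiv ℝ (g ∘ (extChartAt (𝓡 q) m).symm) (extChartAt (𝓡 q) m m) := by
  rw [hg.mvfderiv, ModelWithCorners.Boundaryless.range_eq_univ, fderivWithin_univ]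
  rfl

omit [IsManifold (𝓡 q) ∞ M] [Bundle.RiemannianBundle (fun m : M => TangentSpace (𝓡 q) m)] in
theorem hasFDerivAt_mvfderiv_comp_extChartAt_symm
    {F : Type*} [NormedAddCommGroup F] [NormedSpace ℝ F] {g : M → F} {m : M}
    (hg : MDifferentiableAt (𝓡 q) 𝓘(ℝ, F) g m) :
    HasFDerivAt (g ∘ (extChartAt (𝓡 q) m).symm) (mvfderiv (𝓡 q) g m) (extChartAt (𝓡 q) m m) := by
  have h := (mdifferentiableWithinAt_univ.2 hg).differentiableWithinAt_comp_extChartAt_symm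
  rw [preimage_univ, univ_inter, ModelWithCorners.Boundaryless.range_eq_univ,
    differentiableWithinAt_univ] at h
  rw [mvfderiv_eq_fderiv_comp_extChartAt_symm hg]
  exact h.hasFDerivAt

omit [Bundle.RiemannianBundle (fun m : M => TangentSpace (𝓡 q) m)] in
theorem hasFDerivAt_comp_extChartAt_symm {g : M → ℝ} {m : M} {y : EuclideanSpace ℝ (Fin q)}
    (hy : y ∈ (extChartAt (𝓡 q) m).target)
    (hg : MDifferentiableAt (𝓡 q) 𝓘(ℝ, ℝ) g ((extChartAt (𝓡 q) m).symm y)) :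
    HasFDerivAt (g ∘ (extChartAt (𝓡 q) m).symm)
      (mvfderiv (𝓡 q) g ((extChartAt (𝓡 q) m).symm y) ∘L
        mfderivWithin 𝓘(ℝ, EuclideanSpace ℝ (Fin q)) (𝓡 q) (extChartAt (𝓡 q) m).symm
          (range (𝓡 q)) y) y := by
  have h1 := (mdifferentiableWithinAt_extChartAt_symm hy).hasMFDerivWithinAt
  have h2 := hg.hasMFDerivAt.comp_hasMFDerivWithinAt y h1
  rw [ModelWithCorners.Boundaryless.range_eq_univ] at h2 ⊢
  rw [hasMFDerivWithinAt_univ] at h2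
  exact h2.hasFDerivAt

variable [IsContinuousRiemannianBundle (EuclideanSpace ℝ (Fin q))
      (fun m : M => TangentSpace (𝓡 q) m)]

/-- Near the centre of a chart, derivatives read in the chart are controlled by the intrinsic ones:
the metric is continuous, so the inverse chart has bounded derivative there. -/
theorem exists_norm_fderiv_comp_extChartAt_symm_le (m : M) :
    ∃ B : ℝ, 0 < B ∧ ∃ U : Set (EuclideanSpace ℝ (Fin q)), IsOpen U ∧ extChartAt (𝓡 q) m m ∈ U ∧
      U ⊆ (extChartAt (𝓡 q) m).target ∧ ∀ y ∈ U, ∀ g : M → ℝ,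
        MDifferentiableAt (𝓡 q) 𝓘(ℝ, ℝ) g ((extChartAt (𝓡 q) m).symm y) →
        ‖fderiv ℝ (g ∘ (extChartAt (𝓡 q) m).symm) y‖ ≤
          ‖mvfderiv (𝓡 q) g ((extChartAt (𝓡 q) m).symm y)‖ * B := by
  obtain ⟨B, hB, h⟩ := eventually_norm_mfderivWithin_symm_extChartAt_lt (𝓡 q) m
  rw [ModelWithCorners.Boundaryless.range_eq_univ, nhdsWithin_univ] at h
  obtain ⟨U, hU, hUo, hmU⟩ := eventually_nhds_iff.1
    (h.and (extChartAt_target_mem_nhds (I := 𝓡 q) m))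
  refine ⟨B, hB, U, hUo, hmU, fun y hy => (hU y hy).2, fun y hy g hg => ?_⟩
  let S : TangentSpace (𝓡 q) ((extChartAt (𝓡 q) m).symm y) →L[ℝ] ℝ :=
    mvfderiv (𝓡 q) g ((extChartAt (𝓡 q) m).symm y)
  let T : EuclideanSpace ℝ (Fin q) →L[ℝ] TangentSpace (𝓡 q) ((extChartAt (𝓡 q) m).symm y) :=
    mfderivWithin 𝓘(ℝ, EuclideanSpace ℝ (Fin q)) (𝓡 q) (extChartAt (𝓡 q) m).symm univ y
  have hT : ‖T‖ ≤ B := (hU y hy).1.le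
  have hderiv : HasFDerivAt (g ∘ (extChartAt (𝓡 q) m).symm) (S ∘L T) y := by
    have := hasFDerivAt_comp_extChartAt_symm (hU y hy).2 hg
    rw [ModelWithCorners.Boundaryless.range_eq_univ] at this
    exact this
  rw [hderiv.fderiv]
  exact (ContinuousLinearMap.opNorm_comp_le S T).trans
    (mul_le_mul_of_nonneg_left hT (ContinuousLinearMap.opNorm_nonneg S))

/-- Near the centre of a chart, functions that factor through the chart have intrinsic derivatives
controlled by those in the chart. -/
theorem exists_norm_mvfderiv_comp_extChartAt_le (m : M) :
    ∃ B : ℝ, 0 < B ∧ ∀ᶠ x in 𝓝 m, ∀ G : EuclideanSpace ℝ (Fin q) → ℝ,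
        DifferentiableAt ℝ G (extChartAt (𝓡 q) m x) →
        ‖mvfderiv (𝓡 q) (G ∘ extChartAt (𝓡 q) m) x‖ ≤
          ‖fderiv ℝ G (extChartAt (𝓡 q) m x)‖ * B := by
  obtain ⟨B, hB, h⟩ := eventually_norm_mfderiv_extChartAt_lt (𝓡 q) m
  refine ⟨B, hB, ?_⟩
  filter_upwards [h, chart_source_mem_nhds (EuclideanSpace ℝ (Fin q)) m] with x hx hxs G hG
  have hcomp := mfderiv_comp x hG.mdifferentiableAt (mdifferentiableAt_extChartAt (I := 𝓡 q) hxs)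
  let T : TangentSpace (𝓡 q) x →L[ℝ] EuclideanSpace ℝ (Fin q) :=
    mfderiv (𝓡 q) 𝓘(ℝ, EuclideanSpace ℝ (Fin q)) (extChartAt (𝓡 q) m) x
  have hT : ‖T‖ ≤ B := hx.le
  have heq : mvfderiv (𝓡 q) (G ∘ extChartAt (𝓡 q) m) x =
      (fderiv ℝ G (extChartAt (𝓡 q) m x)) ∘L T := by
    rw [mfderiv_eq_fderiv] at hcomp
    exact hcomp
  rw [heq]
  exact (ContinuousLinearMap.opNorm_comp_le _ T).trans
    (mul_le_mul_of_nonneg_left hT (ContinuousLinearMap.opNorm_nonneg _))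

end Charts

/-! ### The derivative of the synchronisation at a fixed point -/

section Synchronisation

variable {q N : ℕ} {M : Type*} [TopologicalSpace M]
  [ChartedSpace (EuclideanSpace ℝ (Fin q)) M] [IsManifold (𝓡 q) ∞ M]
  [Bundle.RiemannianBundle (fun m : M => TangentSpace (𝓡 q) m)]
  {v : (m : M) → TangentSpace (𝓡 q) m} {φ : ℝ → M → M}

theorem ObsC1.exists_norm_mvfderiv_le (obs : ObsC1 q M) :
    ∃ D, 0 ≤ D ∧ ∀ m, ‖mvfderiv (𝓡 q) obs m‖ ≤ D := by
  obtain ⟨D, hD⟩ := obs.deriv_bounded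
  exact ⟨max D 0, le_max_right _ _, fun m => (hD (mem_range_self m)).trans (le_max_left _ _)⟩

theorem ObsC1.mdifferentiableAt (obs : ObsC1 q M) (m : M) :
    MDifferentiableAt (𝓡 q) 𝓘(ℝ, ℝ) obs m :=
  obs.contMDiff.mdifferentiable one_ne_zero m

omit [Bundle.RiemannianBundle (fun m : M => TangentSpace (𝓡 q) m)] in
theorem IsEvolution.apply_of_eq_zero [T2Space M] (hφ : IsEvolution v φ)
    (hv : ContMDiff (𝓡 q) (𝓡 q).tangent ∞ (fun m => (⟨m, v m⟩ : TangentBundle (𝓡 q) M)))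
    {m : M} (hm : v m = 0) (t : ℝ) : φ t m = m :=
  congrFun (isMIntegralCurve_Ioo_eq_of_contMDiff_boundaryless (t₀ := 0) (I := 𝓡 q)
    (hv.of_le (by norm_cast)) (hφ.integralCurve m) (isMIntegralCurve_const hm) (hφ.zero m)) t

theorem contMDiff_obs_comp (hφ : IsEvolution v φ) (obs : ObsC1 q M) (t : ℝ) :
    ContMDiff (𝓡 q) 𝓘(ℝ, ℝ) 1 (obs ∘ φ t) :=
  obs.contMDiff.comp (hφ.contMDiff t)

theorem norm_mvfderiv_obs_comp_le (hφ : IsEvolution v φ) (obs : ObsC1 q M) {D : ℝ}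
    (hD : ∀ m, ‖mvfderiv (𝓡 q) obs m‖ ≤ D) {t R : ℝ} {m : M}
    (hR : ‖mfderiv (𝓡 q) (𝓡 q) (φ t) m‖ ≤ R) :
    ‖mvfderiv (𝓡 q) (obs ∘ φ t) m‖ ≤ D * R := by
  rw [mvfderiv_comp m (obs.mdifferentiableAt _) ((hφ.contMDiff t).mdifferentiable one_ne_zero m)]
  exact (ContinuousLinearMap.opNorm_comp_le _ _).trans
    (mul_le_mul (hD _) hR (ContinuousLinearMap.opNorm_nonneg _)
      ((ContinuousLinearMap.opNorm_nonneg _).trans (hD m)))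

variable [IsContinuousRiemannianBundle (EuclideanSpace ℝ (Fin q))
      (fun m : M => TangentSpace (𝓡 q) m)]

/-- Read in a chart, `f` is `C¹` near the centre: the growth of `Tφ^{-τ}` is slower than the decay
of `e^{-Aτ}`, so the defining integral may be differentiated under the integral sign. -/
theorem exists_hasFDerivAt_linearGS_comp_extChartAt_symm (hN : 0 < N)
    {A : Matrix (Fin N) (Fin N) ℝ} (hA : A.PosDef) (C : Fin N → ℝ) (hφ : IsEvolution v φ)
    {c K : ℝ} (hc1 : c < 1) (hK : 0 < K)
    (hgrowth : ∀ t, 0 ≤ t → ∀ m : M,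
      ‖mfderiv (𝓡 q) (𝓡 q) (φ (-t)) m‖ ≤ K * Real.exp (c * minEigenvalue A * t))
    (obs : ObsC1 q M) (m : M) :
    ∃ U : Set (EuclideanSpace ℝ (Fin q)), IsOpen U ∧ extChartAt (𝓡 q) m m ∈ U ∧
      U ⊆ (extChartAt (𝓡 q) m).target ∧
      ∃ F' : EuclideanSpace ℝ (Fin q) → EuclideanSpace ℝ (Fin q) →L[ℝ] (Fin N → ℝ),
        (∀ y ∈ U, HasFDerivAt (linearGS A C φ obs ∘ (extChartAt (𝓡 q) m).symm) (F' y) y) ∧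
        ContinuousOn F' U := by
  obtain ⟨b, hb, U, hUo, hmU, hUt, hU⟩ := exists_norm_fderiv_comp_extChartAt_symm_le (q := q) m
  obtain ⟨D₀, hD₀⟩ := obs.exists_abs_le
  obtain ⟨D, hD0, hD⟩ := obs.exists_norm_mvfderiv_le
  obtain ⟨B, hB0, hB⟩ := exists_norm_exp_neg_smul_mulVec_le hA.isHermitian C
  have hσ := minEigenvalue_pos hN hA
  have hcm (t : ℝ) : ContDiffOn ℝ 1 ((obs ∘ φ t) ∘ (extChartAt (𝓡 q) m).symm) U :=
    (((contMDiff_obs_comp hφ obs t).comp_contMDiffOn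
      (contMDiffOn_extChartAt_symm (n := 1) m)).mono hUt).contDiffOn
  refine ⟨U, hUo, hmU, hUt, ?_⟩
  refine exists_hasFDerivAt_integral_smul
    (g := fun τ => (obs ∘ φ (-τ)) ∘ (extChartAt (𝓡 q) m).symm)
    (g' := fun τ => fderiv ℝ ((obs ∘ φ (-τ)) ∘ (extChartAt (𝓡 q) m).symm))
    (bound := fun τ => D * K * b * B * Real.exp (-((1 - c) * minEigenvalue A * τ)))
    hUo ((continuous_exp_smul_mulVec A C).comp continuous_neg) (fun y _ => ?_)
    (fun τ y hy => ?_) (fun τ => ?_) (fun y _ => ?_) ?_ (fun τ hτ y hy => ?_)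
  · exact obs.contMDiff.continuous.comp ((hφ.continuous_orbit _).comp continuous_neg)
  · exact (((hcm (-τ)).differentiableOn one_ne_zero).differentiableAt (hUo.mem_nhds hy)).hasFDerivAt
  · exact (hcm (-τ)).continuousOn_fderiv_of_isOpen hUo le_rfl
  · exact integrableOn_smul_exp_neg_smul_mulVec hN hA C
      (obs.contMDiff.continuous.comp ((hφ.continuous_orbit _).comp continuous_neg)) fun s => hD₀ _
  · exact integrableOn_exp_neg_mul (mul_pos (sub_pos.2 hc1) hσ) _
  · have h1 := hU y hy (obs ∘ φ (-τ))
      ((contMDiff_obs_comp hφ obs (-τ)).mdifferentiable one_ne_zero _)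
    have h2 := norm_mvfderiv_obs_comp_le hφ obs hD
      (hgrowth τ (le_of_lt hτ) ((extChartAt (𝓡 q) m).symm y))
    have h3 := h1.trans (mul_le_mul_of_nonneg_right h2 hb.le)
    refine (mul_le_mul h3 (hB τ (le_of_lt hτ)) (norm_nonneg _) (by positivity)).trans_eq ?_
    have hexp : -((1 - c) * minEigenvalue A * τ) =
      c * minEigenvalue A * τ + -(minEigenvalue A * τ) := by ring
    rw [hexp, Real.exp_add]
    ring

omit [Bundle.RiemannianBundle (fun m : M => TangentSpace (𝓡 q) m)]
  [IsContinuousRiemannianBundle (EuclideanSpace ℝ (Fin q))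
      (fun m : M => TangentSpace (𝓡 q) m)] in
theorem trivializationAt_snd_eq_mfderiv {m x : M}
    (hx : x ∈ (chartAt (EuclideanSpace ℝ (Fin q)) m).source) (w : TangentSpace (𝓡 q) x) :
    (trivializationAt (EuclideanSpace ℝ (Fin q)) (TangentSpace (𝓡 q) (M := M)) m
        (Bundle.TotalSpace.mk' (EuclideanSpace ℝ (Fin q)) x w)).2 =
      mfderiv (𝓡 q) 𝓘(ℝ, EuclideanSpace ℝ (Fin q)) (extChartAt (𝓡 q) m) x w := by
  have h1 : (trivializationAt (EuclideanSpace ℝ (Fin q)) (TangentSpace (𝓡 q) (M := M))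
      m).continuousLinearMapAt ℝ x w =
      (trivializationAt (EuclideanSpace ℝ (Fin q)) (TangentSpace (𝓡 q) (M := M)) m
        (Bundle.TotalSpace.mk' (EuclideanSpace ℝ (Fin q)) x w)).2 := by
    rw [Bundle.Trivialization.continuousLinearMapAt_apply,
      Bundle.Trivialization.coe_linearMapAt_of_mem]
    simpa using hx
  rw [← h1]
  exact DFunLike.congr_fun (TangentBundle.continuousLinearMapAt_trivializationAt hx) w

omit [Bundle.RiemannianBundle (fun m : M => TangentSpace (𝓡 q) m)]
  [IsContinuousRiemannianBundle (EuclideanSpace ℝ (Fin q))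
      (fun m : M => TangentSpace (𝓡 q) m)] in
/-- The coordinate representation of the integral curves: in the chart at `m` they have velocity
given by the trivialised vector field. -/
theorem IsEvolution.hasDerivAt_extChartAt (hφ : IsEvolution v φ) (m : M) {x : M}
    (hx : x ∈ (extChartAt (𝓡 q) m).source) :
    HasDerivAt (fun t => extChartAt (𝓡 q) m (φ t x))
      (trivializationAt (EuclideanSpace ℝ (Fin q)) (TangentSpace (𝓡 q) (M := M)) m
        (Bundle.TotalSpace.mk' (EuclideanSpace ℝ (Fin q)) x (v x))).2 0 := by
  have hxc : x ∈ (chartAt (EuclideanSpace ℝ (Fin q)) m).source := by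
    rwa [extChartAt_source] at hx
  rw [trivializationAt_snd_eq_mfderiv hxc]
  have hγ := hφ.integralCurve x 0
  have h0 := hφ.zero x
  have h1 : HasMFDerivAt (𝓡 q) 𝓘(ℝ, EuclideanSpace ℝ (Fin q)) (extChartAt (𝓡 q) m) (φ 0 x)
      (mfderiv (𝓡 q) 𝓘(ℝ, EuclideanSpace ℝ (Fin q)) (extChartAt (𝓡 q) m) (φ 0 x)) :=
    (mdifferentiableAt_extChartAt (by rwa [h0])).hasMFDerivAt
  let T : ℝ →L[ℝ] EuclideanSpace ℝ (Fin q) :=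
    (mfderiv (𝓡 q) 𝓘(ℝ, EuclideanSpace ℝ (Fin q)) (extChartAt (𝓡 q) m) (φ 0 x)).comp
      ((1 : ℝ →L[ℝ] ℝ).smulRight (v (φ 0 x)))
  have h2 : HasFDerivAt (fun t => extChartAt (𝓡 q) m (φ t x)) T 0 := (h1.comp 0 hγ).hasFDerivAt
  refine h2.hasDerivAt.congr_deriv ?_
  change mfderiv (𝓡 q) 𝓘(ℝ, EuclideanSpace ℝ (Fin q)) (extChartAt (𝓡 q) m) (φ 0 x)
    ((1 : ℝ) • v (φ 0 x)) = _
  rw [one_smul, h0]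

/-- The derivative `L` of `f` at a zero of `v` solves the Sylvester equation
`L J + A L = C ⊗ D obs`. It is the linearisation of the invariance relation
`Df(y) v(y) = -A f(y) + obs(y) C`. -/
theorem linearGS_sylvester (hN : 0 < N) [T2Space M]
    {A : Matrix (Fin N) (Fin N) ℝ} (hA : A.PosDef) (C : Fin N → ℝ) (hφ : IsEvolution v φ)
    (hv : ContMDiff (𝓡 q) (𝓡 q).tangent ∞ (fun m => (⟨m, v m⟩ : TangentBundle (𝓡 q) M)))
    {c K : ℝ} (hc1 : c < 1) (hK : 0 < K)
    (hgrowth : ∀ t, 0 ≤ t → ∀ m : M,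
      ‖mfderiv (𝓡 q) (𝓡 q) (φ (-t)) m‖ ≤ K * Real.exp (c * minEigenvalue A * t))
    (obs : ObsC1 q M) {m : M} (hm : v m = 0) :
    MDifferentiableAt (𝓡 q) 𝓘(ℝ, Fin N → ℝ) (linearGS A C φ obs) m ∧
      ∀ h : EuclideanSpace ℝ (Fin q),
        (mvfderiv (𝓡 q) (linearGS A C φ obs) m : EuclideanSpace ℝ (Fin q) →L[ℝ] (Fin N → ℝ))
          (jacobian v m h) =
        -(A.mulVec ((mvfderiv (𝓡 q) (linearGS A C φ obs) m :
            EuclideanSpace ℝ (Fin q) →L[ℝ] (Fin N → ℝ)) h)) +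
          (mvfderiv (𝓡 q) obs m : EuclideanSpace ℝ (Fin q) →L[ℝ] ℝ) h • C := by
  obtain ⟨U, hUo, hmU, hUt, F', hF', hF'c⟩ := exists_hasFDerivAt_linearGS_comp_extChartAt_symm
    hN hA C hφ hc1 hK hgrowth obs m
  set e := extChartAt (𝓡 q) m
  set f := linearGS A C φ obs
  have hsymm : e.symm (e m) = m := e.left_inv (mem_extChartAt_source m)
  have hdiff : MDifferentiableAt (𝓡 q) 𝓘(ℝ, Fin N → ℝ) f m :=
    mdifferentiableWithinAt_univ.1
      (DifferentiableWithinAt.mdifferentiableWithinAt_of_comp_extChartAt_symm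
        (hF' _ hmU).differentiableAt.differentiableWithinAt)
  have hfm : mvfderiv (𝓡 q) f m = F' (e m) :=
    (mvfderiv_eq_fderiv_comp_extChartAt_symm hdiff).trans (hF' _ hmU).fderiv
  set V : EuclideanSpace ℝ (Fin q) → EuclideanSpace ℝ (Fin q) := fun y =>
    (trivializationAt (EuclideanSpace ℝ (Fin q)) (TangentSpace (𝓡 q) (M := M)) m
      (Bundle.TotalSpace.mk' (EuclideanSpace ℝ (Fin q)) (e.symm y) (v (e.symm y)))).2 with hVdef
  have hV : HasFDerivAt V (jacobian v m) (e m) :=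
    hasFDerivAt_mvfderiv_comp_extChartAt_symm
      (((Bundle.contMDiffAt_section m).1 (hv m)).mdifferentiableAt (by simp))
  have hV0 : V (e m) = 0 := by
    rw [hVdef]
    dsimp only
    rw [hsymm, trivializationAt_snd_eq_mfderiv (mem_chart_source _ m), hm, map_zero]
    rfl
  have hobs : HasFDerivAt (obs ∘ e.symm) (mvfderiv (𝓡 q) obs m) (e m) :=
    hasFDerivAt_mvfderiv_comp_extChartAt_symm (obs.mdifferentiableAt m)
  -- the invariance relation: differentiate `t ↦ f(φ^t x)` at `0` in two ways
  have hinv : ∀ y ∈ U, F' y (V y) = -(A.mulVec ((f ∘ e.symm) y)) + (obs ∘ e.symm) y • C := by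
    intro y hy
    have hx : e.symm y ∈ e.source := e.map_target (hUt hy)
    have h1 := isReservoirSolution_linearGS hN hA C hφ obs (e.symm y) 0
    have h2 := hφ.hasDerivAt_extChartAt m hx
    have hy0 : e (φ 0 (e.symm y)) = y := by rw [hφ.zero, e.right_inv (hUt hy)]
    have h3 : HasFDerivAt (f ∘ e.symm) (F' y) (e (φ 0 (e.symm y))) := by
      rw [hy0]; exact hF' y hy
    have h4 := h3.comp_hasDerivAt 0 h2
    have h5 : (fun t => f (φ t (e.symm y))) =ᶠ[𝓝 0]
        (f ∘ e.symm) ∘ fun t => e (φ t (e.symm y)) := by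
      have : ∀ᶠ t in 𝓝 0, φ t (e.symm y) ∈ e.source :=
        (hφ.continuous_orbit (e.symm y)).continuousAt.eventually_mem
          ((isOpen_extChartAt_source m).mem_nhds (by rwa [hφ.zero]))
      filter_upwards [this] with t ht
      simp only [Function.comp_apply]
      rw [e.left_inv ht]
    have h6 := h1.unique (h4.congr_of_eventuallyEq h5)
    simp only [hφ.zero] at h6
    exact h6.symm
  have hl := hasFDerivAt_apply_of_eq_zero (hF'c.continuousAt (hUo.mem_nhds hmU)) hV hV0
  have hr := (((Matrix.mulVecLin A).toContinuousLinearMap.hasFDerivAt.comp (e m)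
    (hF' _ hmU)).neg.add (hobs.smul_const C)).congr_of_eventuallyEq
      (Filter.eventually_of_mem (hUo.mem_nhds hmU) hinv)
  -- both sides of the invariance relation are differentiable at the zero of `V`
  have heq := hl.unique hr
  refine ⟨hdiff, fun h => ?_⟩
  rw [hfm]
  exact DFunLike.congr_fun heq h

end Synchronisation

/-! ### Sylvester equations -/

section LinearAlgebra

variable {q N : ℕ}

theorem exists_eigenvector_of_charpoly_eq_prod {J : Matrix (Fin q) (Fin q) ℂ} {lam : Fin q → ℂ}
    (hJ : J.charpoly = ∏ j, (Polynomial.X - Polynomial.C (lam j))) (j : Fin q) :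
    ∃ w : Fin q → ℂ, w ≠ 0 ∧ J.mulVec w = lam j • w := by
  have h : Module.End.HasEigenvalue (Matrix.toLin' J) (lam j) := by
    rw [Module.End.hasEigenvalue_iff_isRoot_charpoly, Matrix.charpoly_toLin', hJ,
      Polynomial.IsRoot, Polynomial.eval_prod]
    exact Finset.prod_eq_zero (Finset.mem_univ j) (by simp)
  obtain ⟨w, hw⟩ := h.exists_hasEigenvector
  exact ⟨w, hw.2, by simpa using hw.apply_eq_smul⟩

/-- A real matrix is injective if and only if its complexification is. -/
theorem mulVec_map_injective_iff (L : Matrix (Fin N) (Fin q) ℝ) :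
    Function.Injective (L.map (algebraMap ℝ ℂ)).mulVecLin ↔ Function.Injective L.mulVecLin := by
  rw [injective_iff_map_eq_zero, injective_iff_map_eq_zero]
  have hre (w : Fin q → ℂ) (i : Fin N) :
      ((L.map (algebraMap ℝ ℂ)).mulVec w i).re = L.mulVec (fun k => (w k).re) i := by
    simp [Matrix.mulVec, dotProduct]
  have him (w : Fin q → ℂ) (i : Fin N) :
      ((L.map (algebraMap ℝ ℂ)).mulVec w i).im = L.mulVec (fun k => (w k).im) i := by
    simp [Matrix.mulVec, dotProduct]
  refine ⟨fun h x hx => ?_, fun h w hw => ?_⟩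
  · have := h (fun k => (x k : ℂ)) (by
      funext i
      have hx' := congrFun hx i
      refine Complex.ext ((hre _ i).trans ?_) ((him _ i).trans ?_)
      · simpa using hx'
      · simp [Matrix.mulVec, dotProduct])
    funext k
    simpa using congrFun this k
  · have h1 := h (fun k => (w k).re) (by
      funext i
      exact (hre w i).symm.trans (congrArg Complex.re (congrFun hw i)))
    have h2 := h (fun k => (w k).im) (by
      funext i
      exact (him w i).symm.trans (congrArg Complex.im (congrFun hw i)))
    funext k
    exact Complex.ext (congrFun h1 k) (congrFun h2 k)

/-- If `L` solves the Sylvester equation `L J + A L = C ⊗ ℓ` then `L` maps the eigenvectors `w j` of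
`J` to the multiples `ℓ(w j) (A + λ j)⁻¹ C`, so it is injective exactly when no `ℓ(w j)`
vanishes. -/
theorem injective_iff_of_sylvester {J : Matrix (Fin q) (Fin q) ℂ} {lam : Fin q → ℂ}
    (hlam : Function.Injective lam) {w : Fin q → Fin q → ℂ} (hw0 : ∀ j, w j ≠ 0)
    (hw : ∀ j, J.mulVec (w j) = lam j • w j) {A : Matrix (Fin N) (Fin N) ℂ} {C : Fin N → ℂ}
    (hindep : LinearIndependent ℂ (fun j : Fin q =>
      (A + lam j • (1 : Matrix (Fin N) (Fin N) ℂ))⁻¹.mulVec C))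
    {L : Matrix (Fin N) (Fin q) ℂ} {l : Fin q → ℂ}
    (hL : L * J = -(A * L) + Matrix.vecMulVec C l) :
    Function.Injective L.mulVecLin ↔ ∀ j, w j ⬝ᵥ l ≠ 0 := by
  have hLw (j : Fin q) : L.mulVec (w j) =
      (w j ⬝ᵥ l) • (A + lam j • (1 : Matrix (Fin N) (Fin N) ℂ))⁻¹.mulVec C := by
    have hunit : IsUnit (A + lam j • (1 : Matrix (Fin N) (Fin N) ℂ)).det := by
      -- `⁻¹` is zero on singular matrices, which would contradict linear independence
      by_contra hdet
      refine hindep.ne_zero j ?_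
      simp [Matrix.nonsing_inv_apply_not_isUnit _ hdet]
    have h1 : (A + lam j • (1 : Matrix (Fin N) (Fin N) ℂ)).mulVec (L.mulVec (w j)) =
        (w j ⬝ᵥ l) • C := by
      have h2 := congrArg (fun X => X.mulVec (w j)) hL
      simp only [← Matrix.mulVec_mulVec, hw, Matrix.mulVec_smul, Matrix.add_mulVec,
        Matrix.neg_mulVec, Matrix.vecMulVec_mulVec] at h2
      rw [Matrix.add_mulVec, Matrix.smul_mulVec, Matrix.one_mulVec, h2, dotProduct_comm]
      simp
    rw [← Matrix.mulVec_smul, ← h1, Matrix.mulVec_mulVec, Matrix.nonsing_inv_mul _ hunit,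
      Matrix.one_mulVec]
  refine ⟨fun hinj j hj => hw0 j (hinj ?_), fun hne => ?_⟩
  · rw [map_zero, Matrix.mulVecLin_apply, hLw, hj, zero_smul]
  · have hwi : LinearIndependent ℂ w :=
      Module.End.eigenvectors_linearIndependent' (Matrix.toLin' J) lam hlam w fun j =>
        Module.End.hasEigenvector_iff.2
          ⟨Module.End.mem_eigenspace_iff.2 (by simpa using hw j), hw0 j⟩
    refine LinearMap.injective_of_linearIndependent (v := w)
      (hwi.span_eq_top_of_card_eq_finrank' (by simp)) ?_
    have heq : L.mulVecLin ∘ w = (fun j => Units.mk0 _ (hne j)) • fun j =>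
        (A + lam j • (1 : Matrix (Fin N) (Fin N) ℂ))⁻¹.mulVec C := funext hLw
    rw [heq]
    exact hindep.units_smul _

/-- The value `ℓ(w)` of the complexification of a real functional `ℓ` at a complex vector `w`, given
by its coordinates. -/
noncomputable def complexEval (w : Fin q → ℂ) (l : EuclideanSpace ℝ (Fin q) →L[ℝ] ℝ) : ℂ :=
  ∑ i, w i * (l (EuclideanSpace.single i 1) : ℂ)

/-- Eigenvectors of an operator with distinct eigenvalues decide the injectivity of the solutions of
all Sylvester equations with that operator. -/
theorem exists_eigenvectors_injective_iff
    {J : EuclideanSpace ℝ (Fin q) →L[ℝ] EuclideanSpace ℝ (Fin q)}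
    {lam : Fin q → ℂ} (hJ : J.toLinearMap.charpoly.map (algebraMap ℝ ℂ) =
      ∏ j, (Polynomial.X - Polynomial.C (lam j))) (hlam : Function.Injective lam)
    {A : Matrix (Fin N) (Fin N) ℝ} {C : Fin N → ℝ}
    (hindep : LinearIndependent ℂ (fun j : Fin q =>
      (A.map (algebraMap ℝ ℂ) + lam j • (1 : Matrix (Fin N) (Fin N) ℂ))⁻¹.mulVec
        (fun i => (C i : ℂ)))) :
    ∃ w : Fin q → Fin q → ℂ, (∀ j, w j ≠ 0) ∧
      ∀ (L : EuclideanSpace ℝ (Fin q) →L[ℝ] (Fin N → ℝ)) (l : EuclideanSpace ℝ (Fin q) →L[ℝ] ℝ),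
        (∀ h, L (J h) = -(A.mulVec (L h)) + l h • C) →
        (Function.Injective L ↔ ∀ j, complexEval (w j) l ≠ 0) := by
  set b := (EuclideanSpace.basisFun (Fin q) ℝ).toBasis
  set Jm := LinearMap.toMatrix b b J.toLinearMap with hJm
  have hJc : (Jm.map (algebraMap ℝ ℂ)).charpoly = ∏ j, (Polynomial.X - Polynomial.C (lam j)) := by
    rw [Matrix.charpoly_map, hJm, LinearMap.charpoly_toMatrix, hJ]
  choose w hw0 hw using exists_eigenvector_of_charpoly_eq_prod hJc
  refine ⟨w, hw0, fun L l hLl => ?_⟩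
  set Lm : Matrix (Fin N) (Fin q) ℝ := LinearMap.toMatrix b (Pi.basisFun ℝ (Fin N)) L.toLinearMap
    with hLm
  have hb (i : Fin q) : b i = EuclideanSpace.single i 1 := by simp [b]
  have hLmJ : Lm * Jm = -(A * Lm) + Matrix.vecMulVec C (fun i => l (b i)) := by
    rw [hLm, hJm, ← LinearMap.toMatrix_comp]
    ext k i
    rw [LinearMap.toMatrix_apply]
    simpa [Matrix.vecMulVec_apply, Matrix.mul_apply, Matrix.mulVec, dotProduct,
      LinearMap.toMatrix_apply, mul_comm] using congrFun (hLl (b i)) k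
  have hLinj : Function.Injective L ↔ Function.Injective Lm.mulVecLin := by
    have hcomp : ⇑L = Lm.mulVecLin ∘ b.equivFun := by
      funext x
      exact
        (LinearMap.toMatrix_mulVec_repr b (Pi.basisFun ℝ (Fin N)) L.toLinearMap x).symm
    rw [hcomp]
    exact ⟨fun h => h.of_comp_right b.equivFun.surjective, fun h => h.comp b.equivFun.injective⟩
  rw [hLinj, ← mulVec_map_injective_iff,
    injective_iff_of_sylvester hlam hw0 hw hindep (l := fun i => (l (b i) : ℂ))]
  · simp only [complexEval, dotProduct, hb]
  · have h := congrArg (fun X => X.map (algebraMap ℝ ℂ)) hLmJ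
    ext k i
    simpa [Matrix.mul_apply, Matrix.vecMulVec_apply] using congrFun (congrFun h k) i

end LinearAlgebra

/-! ### The space of observation functions -/

theorem complexEval_add_smul {q : ℕ} (w : Fin q → ℂ) (l l' : EuclideanSpace ℝ (Fin q) →L[ℝ] ℝ)
    (ε : ℝ) : complexEval w (l + ε • l') = complexEval w l + ε * complexEval w l' := by
  simp only [complexEval, Finset.mul_sum, ← Finset.sum_add_distrib]
  refine Finset.sum_congr rfl fun i _ => ?_
  simp only [add_apply, smul_apply, smul_eq_mul]
  push_cast
  ring

section Observations

variable {q : ℕ} {M : Type*} [TopologicalSpace M]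
  [ChartedSpace (EuclideanSpace ℝ (Fin q)) M] [IsManifold (𝓡 q) ∞ M]
  [Bundle.RiemannianBundle (fun m : M => TangentSpace (𝓡 q) m)]

namespace ObsC1

theorem abs_sub_le_dist (a b : ObsC1 q M) (m : M) : |a m - b m| ≤ dist a b :=
  (le_ciSup (bddAbove_sub a b) m).trans
    (le_add_of_nonneg_right (Real.iSup_nonneg fun _ => ContinuousLinearMap.opNorm_nonneg _))

theorem norm_mvfderiv_sub_le_dist (a b : ObsC1 q M) (m : M) :
    ‖mvfderiv (𝓡 q) a m - mvfderiv (𝓡 q) b m‖ ≤ dist a b :=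
  (le_ciSup (bddAbove_deriv_sub a b) m).trans
    (le_add_of_nonneg_left (Real.iSup_nonneg fun _ => abs_nonneg _))

theorem continuous_apply (m : M) : Continuous fun a : ObsC1 q M => a m :=
  (LipschitzWith.of_dist_le_mul (K := 1) fun a b => by
    simpa [Real.dist_eq] using abs_sub_le_dist a b m).continuous

theorem continuous_mvfderiv_apply (m : M) (e : TangentSpace (𝓡 q) m) :
    Continuous fun a : ObsC1 q M => mvfderiv (𝓡 q) a m e :=
  (LipschitzWith.of_dist_le_mul (K := ‖e‖₊) fun a b => by
    rw [Real.dist_eq, ← Real.norm_eq_abs, mul_comm]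
    exact ((mvfderiv (𝓡 q) a m - mvfderiv (𝓡 q) b m).le_opNorm e).trans
      (mul_le_mul_of_nonneg_right (norm_mvfderiv_sub_le_dist a b m) (norm_nonneg e))).continuous

omit [IsManifold (𝓡 q) ∞ M] [Bundle.RiemannianBundle (fun m : M => TangentSpace (𝓡 q) m)] in
theorem mvfderiv_add_smul {a b : M → ℝ} {m : M} (ha : MDifferentiableAt (𝓡 q) 𝓘(ℝ, ℝ) a m)
    (hb : MDifferentiableAt (𝓡 q) 𝓘(ℝ, ℝ) b m) (ε : ℝ) :
    mvfderiv (𝓡 q) (fun x => a x + ε * b x) m = mvfderiv (𝓡 q) a m + ε • mvfderiv (𝓡 q) b m :=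
  (ha.hasMFDerivAt.add (hb.hasMFDerivAt.const_smul ε)).mfderiv

/-- The observation function `a + ε b`. -/
def addSMul (a b : ObsC1 q M) (ε : ℝ) : ObsC1 q M where
  toFun x := a x + ε * b x
  contMDiff := a.contMDiff.add (contMDiff_const.mul b.contMDiff)
  bounded := by
    obtain ⟨x, hx⟩ := a.bounded
    obtain ⟨y, hy⟩ := b.bounded
    refine ⟨x + |ε| * y, ?_⟩
    rintro _ ⟨m, rfl⟩
    refine (abs_add_le _ _).trans (add_le_add (hx ⟨m, rfl⟩) ?_)
    rw [abs_mul]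
    exact mul_le_mul_of_nonneg_left (hy ⟨m, rfl⟩) (abs_nonneg ε)
  deriv_bounded := by
    obtain ⟨x, hx⟩ := a.deriv_bounded
    obtain ⟨y, hy⟩ := b.deriv_bounded
    refine ⟨x + |ε| * y, ?_⟩
    rintro _ ⟨m, rfl⟩
    dsimp only
    rw [mvfderiv_add_smul (a.mdifferentiableAt m) (b.mdifferentiableAt m)]
    refine (ContinuousLinearMap.opNorm_add_le _ _).trans
      (add_le_add (hx (mem_range_self m)) ?_)
    exact (ContinuousLinearMap.opNorm_smul_le ε _).trans
      (mul_le_mul_of_nonneg_left (hy (mem_range_self m)) (abs_nonneg ε))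

theorem mvfderiv_addSMul (a b : ObsC1 q M) (ε : ℝ) (m : M) :
    mvfderiv (𝓡 q) (addSMul a b ε) m = mvfderiv (𝓡 q) a m + ε • mvfderiv (𝓡 q) b m :=
  mvfderiv_add_smul (a.mdifferentiableAt m) (b.mdifferentiableAt m) ε

theorem exists_dist_addSMul_le (a b : ObsC1 q M) :
    ∃ R : ℝ, 0 ≤ R ∧ ∀ ε, dist a (addSMul a b ε) ≤ |ε| * R := by
  obtain ⟨D, hD⟩ := b.exists_abs_le
  obtain ⟨D', hD'0, hD'⟩ := b.exists_norm_mvfderiv_le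
  refine ⟨max D 0 + D', by positivity, fun ε => ?_⟩
  rw [mul_add]
  refine add_le_add (Real.iSup_le (fun m => ?_) (by positivity))
    (Real.iSup_le (fun m => ?_) (by positivity))
  · have : a m - addSMul a b ε m = -(ε * b m) := by simp [addSMul]
    rw [this, abs_neg, abs_mul]
    exact mul_le_mul_of_nonneg_left ((hD m).trans (le_max_left _ _)) (abs_nonneg ε)
  · rw [mvfderiv_addSMul, sub_add_cancel_left]
    refine (norm_neg _).trans_le ((ContinuousLinearMap.opNorm_smul_le ε _).trans
      (mul_le_mul_of_nonneg_left (hD' m) (abs_nonneg ε)))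

/-- The complement of the kernel of a nonzero real-linear functional is dense. -/
theorem dense_ne_zero {Φ : ObsC1 q M → ℂ} (b : ObsC1 q M)
    (hΦ : ∀ a (ε : ℝ), Φ (addSMul a b ε) = Φ a + ε * Φ b) (hb : Φ b ≠ 0) :
    Dense {a | Φ a ≠ 0} := by
  intro a
  by_cases ha : Φ a = 0
  swap
  · exact subset_closure ha
  obtain ⟨R, hR0, hR⟩ := exists_dist_addSMul_le a b
  refine Metric.mem_closure_iff.2 fun δ hδ => ?_
  have hε : 0 < δ / (R + 1) := by positivity
  refine ⟨addSMul a b (δ / (R + 1)), ?_, (hR _).trans_lt ?_⟩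
  · rw [mem_ofPred_eq, hΦ, ha, zero_add]
    exact mul_ne_zero (by exact_mod_cast hε.ne') hb
  · rw [abs_of_pos hε, div_mul_eq_mul_div, div_lt_iff₀ (by positivity)]
    nlinarith

/-- Finitely many nonzero linear functionals are simultaneously nonzero on an open dense set. -/
theorem isOpen_and_dense_forall_ne_zero {κ : Type*} [Finite κ] {Φ : κ → ObsC1 q M → ℂ}
    (hcont : ∀ k, Continuous (Φ k))
    (hlin : ∀ k a b (ε : ℝ), Φ k (addSMul a b ε) = Φ k a + ε * Φ k b)
    (hne : ∀ k, ∃ b, Φ k b ≠ 0) :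
    IsOpen {a | ∀ k, Φ k a ≠ 0} ∧ Dense {a | ∀ k, Φ k a ≠ 0} := by
  have hopen (k : κ) : IsOpen {a | Φ k a ≠ 0} := isOpen_ne_fun (hcont k) continuous_const
  have hdense (k : κ) : Dense {a | Φ k a ≠ 0} := by
    obtain ⟨b, hb⟩ := hne k
    exact dense_ne_zero b (fun a ε => hlin k a b ε) hb
  rw [ofPred_forall]
  refine ⟨isOpen_iInter_of_finite hopen, ?_⟩
  rw [← sInter_range]
  exact (finite_range _).dense_sInter (forall_mem_range.2 hopen) (forall_mem_range.2 hdense)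

variable [T2Space M] [IsContinuousRiemannianBundle (EuclideanSpace ℝ (Fin q))
      (fun m : M => TangentSpace (𝓡 q) m)]

/-- Any smooth function of the coordinates is the germ at `m` of an observation function supported
in a prescribed neighbourhood of `m`. -/
theorem exists_eventuallyEq_comp_extChartAt (m : M) {V : Set M} (hV : V ∈ 𝓝 m)
    {G : EuclideanSpace ℝ (Fin q) → ℝ} (hG : ContDiff ℝ ∞ G) :
    ∃ b : ObsC1 q M, b =ᶠ[𝓝 m] G ∘ extChartAt (𝓡 q) m ∧ ∀ x ∉ V, b x = 0 := by
  obtain ⟨B, hB, hW⟩ := exists_norm_mvfderiv_comp_extChartAt_le (q := q) m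
  obtain ⟨f, -, hf⟩ := (SmoothBumpFunction.nhds_basis_tsupport (I := 𝓡 q) m).mem_iff.1
    (inter_mem hV hW)
  set h : EuclideanSpace ℝ (Fin q) → ℝ := fun y => f.toContDiffBump y * G y with hh
  have hhs : ContDiff ℝ ∞ h := f.toContDiffBump.contDiff.mul hG
  have hhc : HasCompactSupport h := f.toContDiffBump.hasCompactSupport.mul_right
  obtain ⟨D, hD⟩ := hhc.exists_bound_of_continuous hhs.continuous
  obtain ⟨D', hD'⟩ := (hhc.fderiv (𝕜 := ℝ)).exists_bound_of_continuous
    (hhs.continuous_fderiv (by simp))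
  set b : M → ℝ := fun x => f x • G (extChartAt (𝓡 q) m x) with hb
  have hbs : ContMDiff (𝓡 q) 𝓘(ℝ, ℝ) ∞ b :=
    f.contMDiff_smul (hG.contMDiff.comp_contMDiffOn contMDiffOn_extChartAt)
  have hbh {x : M} (hx : x ∈ tsupport f) : b =ᶠ[𝓝 x] h ∘ extChartAt (𝓡 q) m := by
    filter_upwards [(chartAt (EuclideanSpace ℝ (Fin q)) m).open_source.mem_nhds
      (f.tsupport_subset_chartAt_source hx)] with y hy
    rw [hb, hh]
    simp only [Function.comp_apply, smul_eq_mul]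
    rw [f.eqOn_source hy]
    rfl
  have hb0 {x : M} (hx : x ∉ tsupport f) : b =ᶠ[𝓝 x] fun _ => 0 := by
    filter_upwards [(isClosed_tsupport f).isOpen_compl.mem_nhds hx] with y hy
    simp [hb, image_eq_zero_of_notMem_tsupport hy]
  refine ⟨⟨b, hbs.of_le (by norm_cast), ⟨max D 0, ?_⟩, ⟨max (D' * B) 0, ?_⟩⟩, ?_, ?_⟩
  · rintro _ ⟨x, rfl⟩
    by_cases hx : x ∈ tsupport f
    · dsimp only
      rw [(hbh hx).eq_of_nhds]
      exact (hD _).trans (le_max_left _ _)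
    · dsimp only
      rw [(hb0 hx).eq_of_nhds, abs_zero]
      exact le_max_right _ _
  · rintro _ ⟨x, rfl⟩
    by_cases hx : x ∈ tsupport f
    · have h1 : mvfderiv (𝓡 q) b x = mvfderiv (𝓡 q) (h ∘ extChartAt (𝓡 q) m) x :=
        (hbh hx).mfderiv_eq
      have h2 := (hf hx).2 h (hhs.differentiable (by simp) _)
      dsimp only
      rw [h1]
      exact (h2.trans (mul_le_mul_of_nonneg_right (hD' _) hB.le)).trans (le_max_left _ _)
    · have h1 : mvfderiv (𝓡 q) b x = 0 :=
        (hb0 hx).mfderiv_eq.trans (mvfderiv_const (I := 𝓡 q) (0 : ℝ))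
      dsimp only
      rw [h1]
      exact ContinuousLinearMap.opNorm_zero.trans_le (le_max_right _ _)
  · filter_upwards [f.eventuallyEq_one] with x hx
    simp [hb, hx]
  · intro x hx
    exact (hb0 fun h => hx (hf h).1).eq_of_nhds

omit [T2Space M] [IsContinuousRiemannianBundle (EuclideanSpace ℝ (Fin q))
      (fun m : M => TangentSpace (𝓡 q) m)] in
theorem continuous_complexEval (m : M) (w : Fin q → ℂ) :
    Continuous fun a : ObsC1 q M => complexEval w (mvfderiv (𝓡 q) a m) :=
  continuous_finsetSum _ fun i _ => continuous_const.mul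
    (Complex.continuous_ofReal.comp (continuous_mvfderiv_apply m (EuclideanSpace.single i 1)))

omit [T2Space M] [IsContinuousRiemannianBundle (EuclideanSpace ℝ (Fin q))
      (fun m : M => TangentSpace (𝓡 q) m)] in
theorem complexEval_addSMul (m : M) (w : Fin q → ℂ) (a b : ObsC1 q M) (ε : ℝ) :
    complexEval w (mvfderiv (𝓡 q) (addSMul a b ε) m) =
      complexEval w (mvfderiv (𝓡 q) a m) + ε * complexEval w (mvfderiv (𝓡 q) b m) :=
  (congrArg (complexEval w) (mvfderiv_addSMul a b ε m)).trans (complexEval_add_smul w _ _ ε)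

/-- A nonzero complex tangent vector is detected by a coordinate function. -/
theorem exists_complexEval_ne_zero (m : M) {w : Fin q → ℂ} (hw : w ≠ 0) :
    ∃ b : ObsC1 q M, complexEval w (mvfderiv (𝓡 q) b m) ≠ 0 := by
  obtain ⟨i, hi⟩ := Function.ne_iff.1 hw
  obtain ⟨b, hb, -⟩ := exists_eventuallyEq_comp_extChartAt m univ_mem
    (EuclideanSpace.proj i : EuclideanSpace ℝ (Fin q) →L[ℝ] ℝ).contDiff
  refine ⟨b, ?_⟩
  have hderiv : mvfderiv (𝓡 q) b m =
      (EuclideanSpace.proj i : EuclideanSpace ℝ (Fin q) →L[ℝ] ℝ) := by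
    rw [mvfderiv_eq_fderiv_comp_extChartAt_symm (b.mdifferentiableAt m)]
    refine HasFDerivAt.fderiv (((EuclideanSpace.proj i :
      EuclideanSpace ℝ (Fin q) →L[ℝ] ℝ).hasFDerivAt).congr_of_eventuallyEq ?_)
    have h1 := continuousAt_extChartAt_symm (I := 𝓡 q) m
    rw [ContinuousAt, extChartAt_to_inv] at h1
    filter_upwards [h1.eventually hb, extChartAt_target_mem_nhds (I := 𝓡 q) m] with y hy hyt
    rw [Function.comp_apply, hy, Function.comp_apply, (extChartAt (𝓡 q) m).right_inv hyt]
  rw [hderiv]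
  simpa [complexEval, PiLp.single_apply, apply_ite (Complex.ofReal)] using hi

theorem exists_apply_ne {m m' : M} (h : m ≠ m') : ∃ b : ObsC1 q M, b m ≠ b m' := by
  obtain ⟨b, hb, hb0⟩ := exists_eventuallyEq_comp_extChartAt (q := q) m (isOpen_ne.mem_nhds h)
    (contDiff_const (c := (1 : ℝ)))
  refine ⟨b, ?_⟩
  rw [hb.eq_of_nhds, hb0 m' (by simp)]
  exact one_ne_zero

end ObsC1

end Observations

/-! ### Embedding of the fixed points -/

section Main

variable {q N : ℕ} {M : Type*} [TopologicalSpace M]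
  [ChartedSpace (EuclideanSpace ℝ (Fin q)) M] [IsManifold (𝓡 q) ∞ M]
  [Bundle.RiemannianBundle (fun m : M => TangentSpace (𝓡 q) m)]
  {v : (m : M) → TangentSpace (𝓡 q) m} {φ : ℝ → M → M}

/-- At the fixed points `f = obs • A⁻¹ C`, so `f` separates them exactly when `obs` does. -/
theorem linearGS_injOn_iff (hN : 0 < N) {A : Matrix (Fin N) (Fin N) ℝ} (hA : A.PosDef)
    {C : Fin N → ℝ} {X : Set M} (hC : X.Nonempty → C ≠ 0) (hφ : IsEvolution v φ)
    (hX : ∀ m ∈ X, ∀ t, φ t m = m) (obs : ObsC1 q M) :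
    InjOn (linearGS A C φ obs) X ↔ InjOn obs X := by
  have key : ∀ m ∈ X, ∀ m' ∈ X,
      (linearGS A C φ obs m = linearGS A C φ obs m' ↔ obs m = obs m') := by
    intro m hm m' hm'
    rw [← (Matrix.mulVec_injective_iff_isUnit.2 hA.isUnit).eq_iff,
      mulVec_linearGS_of_fixed hN hA C hφ obs (hX m hm),
      mulVec_linearGS_of_fixed hN hA C hφ obs (hX m' hm')]
    exact (smul_left_injective ℝ (hC ⟨m, hm⟩)).eq_iff
  exact ⟨fun h m hm m' hm' e => h hm hm' ((key m hm m' hm').2 e),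
    fun h m hm m' hm' e => h hm hm' ((key m hm m' hm').1 e)⟩

end Main

theorem mainTheorem3 {q N : ℕ} (hq : 0 < q) (hqN : q ≤ N)
    {M : Type*} [TopologicalSpace M] [T2Space M] [SecondCountableTopology M]
    [ChartedSpace (EuclideanSpace ℝ (Fin q)) M] [IsManifold (𝓡 q) ∞ M]
    [Bundle.RiemannianBundle (fun m : M => TangentSpace (𝓡 q) m)]
    [IsContinuousRiemannianBundle (EuclideanSpace ℝ (Fin q))
      (fun m : M => TangentSpace (𝓡 q) m)]
    (v : (m : M) → TangentSpace (𝓡 q) m)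
    (hv : ContMDiff (𝓡 q) (𝓡 q).tangent ∞
      (fun m => (⟨m, v m⟩ : TangentBundle (𝓡 q) M)))
    (φ : ℝ → M → M) (hφ : IsEvolution v φ)
    (A : Matrix (Fin N) (Fin N) ℝ) (hA : A.PosDef) (C : Fin N → ℝ)
    (c K : ℝ) (hc0 : 0 < c) (hc1 : c < 1) (hK : 0 < K)
    (hgrowth : ∀ t, 0 ≤ t → ∀ m : M,
      ‖mfderiv (𝓡 q) (𝓡 q) (φ (-t)) m‖ ≤ K * Real.exp (c * minEigenvalue A * t))
    (hfin : {m : M | v m = 0}.Finite)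
    (lam : M → Fin q → ℂ)
    (heig : ∀ m, v m = 0 →
      (jacobian v m).toLinearMap.charpoly.map (algebraMap ℝ ℂ) =
        ∏ j, (Polynomial.X - Polynomial.C (lam m j)))
    (hdistinct : ∀ m, v m = 0 → Function.Injective (lam m))
    (hindep : ∀ m, v m = 0 →
      LinearIndependent ℂ (fun j : Fin q =>
        (A.map (algebraMap ℝ ℂ) + lam m j • (1 : Matrix (Fin N) (Fin N) ℂ))⁻¹.mulVec
          (fun i => (C i : ℂ)))) :
    (∀ obs : ObsC1 q M,
      IsGeneralisedSync (linearReservoir A C) φ obs univ (linearGS A C φ obs)) ∧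
    IsOpen {obs : ObsC1 q M | IsEmbeddingOn (q := q) (linearGS A C φ obs) {m : M | v m = 0}} ∧
    Dense {obs : ObsC1 q M | IsEmbeddingOn (q := q) (linearGS A C φ obs) {m : M | v m = 0}} := by
  have hN : 0 < N := hq.trans_le hqN
  refine ⟨isGeneralisedSync_linearGS hN hA C hφ, ?_⟩
  set X : Set M := {m : M | v m = 0} with hX
  have hC : X.Nonempty → C ≠ 0 := by
    rintro ⟨m, hm⟩ rfl
    exact (hindep m hm).ne_zero ⟨0, hq⟩ (by
      simp only [Pi.zero_apply, Complex.ofReal_zero]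
      exact Matrix.mulVec_zero _)
  have hw : ∀ m, v m = 0 → ∃ w : Fin q → Fin q → ℂ, (∀ j, w j ≠ 0) ∧
      ∀ (L : EuclideanSpace ℝ (Fin q) →L[ℝ] (Fin N → ℝ)) (l : EuclideanSpace ℝ (Fin q) →L[ℝ] ℝ),
        (∀ h, L (jacobian v m h) = -(A.mulVec (L h)) + l h • C) →
        (Function.Injective L ↔ ∀ j, complexEval (w j) l ≠ 0) := fun m hm =>
    exists_eigenvectors_injective_iff (heig m hm) (hdistinct m hm) (hindep m hm)
  choose! w hw0 hw using hw
  -- one functional for each eigenvector at each fixed point, one for each pair of fixed points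
  let Φ : (X × Fin q) ⊕ {p : X × X // p.1 ≠ p.2} → ObsC1 q M → ℂ :=
    Sum.elim (fun k obs => complexEval (w k.1 k.2) (mvfderiv (𝓡 q) obs k.1))
      (fun p obs => ((obs p.1.1 - obs p.1.2 : ℝ) : ℂ))
  have hset : {obs : ObsC1 q M | IsEmbeddingOn (q := q) (linearGS A C φ obs) X} =
      {obs | ∀ k, Φ k obs ≠ 0} := by
    ext obs
    have himm : (∀ m ∈ X, MDifferentiableAt (𝓡 q) 𝓘(ℝ, Fin N → ℝ) (linearGS A C φ obs) m ∧
        Function.Injective (mvfderiv (𝓡 q) (linearGS A C φ obs) m)) ↔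
        ∀ k : X × Fin q, complexEval (w k.1 k.2) (mvfderiv (𝓡 q) obs k.1) ≠ 0 := by
      rw [Prod.forall, Subtype.forall]
      refine forall₂_congr fun m hm => ?_
      obtain ⟨hdiff, hsylv⟩ := linearGS_sylvester hN hA C hφ hv hc1 hK hgrowth obs hm
      have hiff := hw m hm (mvfderiv (𝓡 q) (linearGS A C φ obs) m) (mvfderiv (𝓡 q) obs m) hsylv
      exact ⟨fun h => hiff.1 h.2, fun h => ⟨hdiff, hiff.2 h⟩⟩
    have hinj : InjOn (linearGS A C φ obs) X ↔
        ∀ p : {p : X × X // p.1 ≠ p.2}, ((obs p.1.1 - obs p.1.2 : ℝ) : ℂ) ≠ 0 := by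
      rw [linearGS_injOn_iff hN hA hC hφ (fun m hm t => hφ.apply_of_eq_zero hv hm t)]
      simp only [ne_eq, Complex.ofReal_eq_zero, sub_eq_zero]
      constructor
      · intro h p hp
        exact p.2 (Subtype.ext (h p.1.1.2 p.1.2.2 hp))
      · intro h m hm m' hm' e
        by_contra hne
        exact h ⟨(⟨m, hm⟩, ⟨m', hm'⟩), fun h' => hne (congrArg Subtype.val h')⟩ e
    exact (and_congr himm hinj).trans (Sum.forall (p := fun k => Φ k obs ≠ 0)).symm
  have : Finite X := hfin
  rw [hset]
  refine ObsC1.isOpen_and_dense_forall_ne_zero ?_ ?_ ?_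
  · rintro (k | p)
    · exact ObsC1.continuous_complexEval _ _
    · exact Complex.continuous_ofReal.comp
        ((ObsC1.continuous_apply _).sub (ObsC1.continuous_apply _))
  · rintro (k | p) a b ε
    · exact ObsC1.complexEval_addSMul _ _ a b ε
    · simp only [Φ, Sum.elim_inr, ObsC1.addSMul]
      push_cast
      ring
  · rintro (k | p)
    · exact ObsC1.exists_complexEval_ne_zero _ (hw0 _ k.1.2 k.2)
    · obtain ⟨b, hb⟩ := ObsC1.exists_apply_ne (q := q)
        (fun h => p.2 (Subtype.ext h) : (p.1.1 : M) ≠ p.1.2)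
      exact ⟨b, by simpa [Φ, sub_eq_zero] using hb⟩
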